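/- Let $k_\theta(x)=\sum_{j\in\mathbb Z}\frac{\phi}{(\alpha^2+j^2)^{\nu+1/2}}\,e^{2\pi i jx}$ for $\theta=(\nu,\phi,\alpha)\in(0,\infty)^3$. Let $\theta_0=(\nu_0,\phi_0,\alpha_0)\in(0,\infty)^3$ and let $\xi$ be a centered real Gaussian process on $[0,1]$ with covariance $\operatorname{Cov}(\xi(x),\xi(y))=k_{\theta_0}(x-y)$. For $n\ge 1$ let $Z=(\xi(0),\xi(1/n),\dots,\xi((n-1)/n))^{\mathsf T}$, let $K_\theta=\big(k_\theta((a-b)/n)\big)_{0\le a,b\le n-1}$, and let $$\mathcal L_n(\theta)=\frac1n\Big(\ln\det K_\theta+Z^{\mathsf T}K_\theta^{-1}Z\Big).$$ Let $\Theta=[a_\nu,b_\nu]\times(0,\infty)\times[a_\alpha,b_\alpha]$ with $0<a_\nu\le\nu_0\le b_\nu<\infty$ and $0<a_\alpha\le b_\alpha<\infty$ ($\alpha_0$ need not belong to $[a_\alpha,b_\alpha]$), and for each $n\ge1$ let $\hat\theta_n=(\hat\nu_n,\hat\phi_n,\hat\alpha_n)$ be a maximum likelihood estimate, i.e. almost surely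 a minimizer of $\mathcal L_n$ over $\Theta$, with ties broken arbitrarily. Theorem. For every $0<\beta<1/4$, $$\hat\nu_n-\nu_0=o_P\big(n^{-\beta}\big)\qquad\text{and}\qquad \hat\phi_n-\phi_0=o_P\big(\ln(n)\,n^{-\beta}\big)\qquad(n\to\infty),$$ where $X_n=o_P(a_n)$ means that $X_n/a_n\to0$ in probability. -/

import Mathlib

open MeasureTheory ProbabilityTheory Filter Topology Set
open scoped Matrix

noncomputable section

/-- The parameter `θ = (ν, φ, α)`: regularity, amplitude and inverse range. -/
structure MaternParam where
  nu : ℝ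
  phi : ℝ
  alpha : ℝ

/-- Fourier coefficient `c_j(θ) = φ / (α² + j²)^(ν + 1/2)`. -/
def maternCoeff (θ : MaternParam) (j : ℤ) : ℝ :=
  θ.phi / (θ.alpha ^ 2 + (j : ℝ) ^ 2) ^ (θ.nu + 1 / 2)

/-- The stationary covariance function `k_θ(x) = ∑_{j ∈ ℤ} c_j(θ) e^{2πijx}`. The Fourier series
is absolutely convergent for `ν, α > 0`, and its sum is real because `c_{-j} = c_j`. -/
def maternKernel (θ : MaternParam) (x : ℝ) : ℝ :=
  (∑' j : ℤ, (maternCoeff θ j : ℂ) * Complex.exp (2 * Real.pi * Complex.I * x * j)).re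

/-- `ξ`, restricted to `[0, 1]`, is a centered Gaussian process with covariance function
`(x, y) ↦ k_θ(x - y)`. -/
structure IsMaternProcess {Ω : Type*} [MeasurableSpace Ω] (ξ : ℝ → Ω → ℝ) (θ : MaternParam)
    (P : Measure Ω) : Prop where
  gaussian : IsGaussianProcess (fun (x : Icc (0 : ℝ) 1) => ξ x) P
  centered : ∀ x ∈ Icc (0 : ℝ) 1, ∫ ω, ξ x ω ∂P = 0
  cov_eq : ∀ x ∈ Icc (0 : ℝ) 1, ∀ y ∈ Icc (0 : ℝ) 1,
    covariance (ξ x) (ξ y) P = maternKernel θ (x - y)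

/-- The data `Z = (f(0), f(1/n), …, f((n-1)/n))`. -/
def gridData (f : ℝ → ℝ) (n : ℕ) : Fin n → ℝ :=
  fun a => f ((a : ℝ) / n)

/-- The covariance matrix `K_θ` of the data under `θ`. -/
def maternCovMatrix (θ : MaternParam) (n : ℕ) : Matrix (Fin n) (Fin n) ℝ :=
  Matrix.of fun a b => maternKernel θ ((a : ℝ) / n - (b : ℝ) / n)

/-- The normalised negative log-likelihood
`L_n(θ) = n⁻¹ (ln det K_θ + Zᵀ K_θ⁻¹ Z)`. -/
def negLogLik (n : ℕ) (z : Fin n → ℝ) (θ : MaternParam) : ℝ :=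
  (n : ℝ)⁻¹ * (Real.log (maternCovMatrix θ n).det + z ⬝ᵥ ((maternCovMatrix θ n)⁻¹ *ᵥ z))

/-- The parameter set `Θ = N × (0, ∞) × A`. -/
def paramSet (N A : Set ℝ) : Set MaternParam :=
  {θ | θ.nu ∈ N ∧ 0 < θ.phi ∧ θ.alpha ∈ A}

/-- `θ` is a maximum likelihood estimate over `Θ` from the data `z`. -/
def IsMLE (Θ : Set MaternParam) (n : ℕ) (z : Fin n → ℝ) (θ : MaternParam) : Prop :=
  θ ∈ Θ ∧ IsMinOn (negLogLik n z) Θ θ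

/-- `X_n = o_P(a_n)`: the ratio `X_n / a_n` converges to zero in probability. (The definition is
meant for rates `a_n` that are positive for all large `n`.) -/
def IsLittleOInProbability {Ω : Type*} [MeasurableSpace Ω] (P : Measure Ω)
    (X : ℕ → Ω → ℝ) (a : ℕ → ℝ) : Prop :=
  TendstoInMeasure P (fun n ω => X n ω / a n) atTop (fun _ => 0)

end

/-!
The covariance matrices on the regular grid are circulant and symmetric, hence all diagonal in one
real orthonormal basis, that of the discrete Hartley transform (`maternCovMatrix_eq`). The
eigenvalue at frequency `m` is `n φ` times the aliased spectrum
`∑_l (α² + (m + l n)²)^(-ν - 1/2)`. The likelihood therefore decouples over frequencies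
(`negLogLik_eq`), and under the true parameter the squared Hartley coefficients divided by their
variances are independent squares `U_m` of standard Gaussian variables
(`IsMaternProcess.periodogram_moments`).

Let `r_m` be the logarithm of the ratio of the aliased spectra at `θ₀` and at `θ`. Minimising over
`φ` gives `φ = φ₀ · avg (exp r_m · U_m)`, and `(ν, α)` then minimises
`log avg (exp r_m · U_m) - avg r_m` (`IsMLE.profile`). Up to errors `O(1 / (1 + q²))`, where
`q = min m (n - m)`, the range `α` plays no role (`abs_log_aliasSum_sub_le`), and `r_m` equals
`(ν - ν₀) log (1 + q²)` plus a remainder that is Lipschitz in `ν` uniformly in `m` and `n`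
(`exists_lipschitz_logAliasRemainder`). So on a block of low frequencies (a small multiple of `n`)
and on one of high frequencies the values of `r_m` differ by at least `|ν - ν₀|`. By a quantitative
Jensen inequality (`log_sum_mul_exp_ge`) with the random weights `U_m / ∑ U`, the profile objective
exceeds its value at `ν = ν₀` by a multiple of `(ν - ν₀)²`, up to a linear noise term
`avg ((U_m - 1) r_m)`. Because Jensen's inequality is used with the random weights, no case
distinction is needed for `ν` far below `ν₀`, where `exp r_m` is unbounded in mean square.

The noise is controlled uniformly in `ν` by its increments over a grid of `n` regularities, and its
expectation is `O(log n / √n)` (`exists_integral_fluctuation_le`). With one more logarithm for the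
size of `r_m`, `(ν̂ - ν₀)² = O_P((log n)² / √n)`, which gives every rate `n ^ (-β)` with `β < 1/4`.
The formula for the amplitude then yields `φ̂ - φ₀ = O_P(log n · |ν̂ - ν₀| + log n / √n)`
(`exists_abs_avg_exp_logRatio_sub_one_le`).
-/

/-! ### Folded frequencies and aliased spectral sums -/

/-- The distance from `m` to the nearer of `0` and `n`, i.e. the smallest absolute value of a
frequency that is aliased to `m` on the grid with `n` points. -/
noncomputable def foldFreq (n m : ℕ) : ℝ := min (m : ℝ) ((n : ℝ) - m)

/-- The aliased spectrum `∑_{l ∈ ℤ} (α² + (m + l n)²)^(-s)`. Up to the factor `n φ` it is, for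
`s = ν + 1/2`, the eigenvalue of the covariance matrix at frequency `m`. -/
noncomputable def aliasSum (s α : ℝ) (n m : ℕ) : ℝ :=
  ∑' l : ℤ, (α ^ 2 + ((m : ℝ) + l * n) ^ 2) ^ (-s)

/-- The logarithm of the aliased spectrum at `α = 1`, freed of its leading term
`-s log (1 + q²)`, where `q` is the folded frequency. -/
noncomputable def logAliasRemainder (n m : ℕ) (s : ℝ) : ℝ :=
  Real.log (aliasSum s 1 n m) + s * Real.log (1 + foldFreq n m ^ 2)

lemma foldFreq_nonneg {n m : ℕ} (h : m ≤ n) : 0 ≤ foldFreq n m := by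
  have : (m : ℝ) ≤ n := by exact_mod_cast h
  exact le_min (by positivity) (by linarith)

lemma foldFreq_le {n m : ℕ} (h : m ≤ n) : foldFreq n m ≤ n := by
  have : (m : ℝ) ≤ n := by exact_mod_cast h
  exact (min_le_left _ _).trans this

lemma one_add_sq_mul_le {q l j : ℝ} (hq : 0 ≤ q) (hl : 0 ≤ l) (h1 : q ≤ j) (h2 : l ≤ j)
    (h3 : l * q ≤ j) : (1 + q ^ 2) * (1 + l ^ 2) ≤ 3 * (1 + j ^ 2) := by
  have e1 : q ^ 2 ≤ j ^ 2 := by gcongr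
  have e2 : l ^ 2 ≤ j ^ 2 := by gcongr
  have e3 : (l * q) ^ 2 ≤ j ^ 2 := by gcongr
  nlinarith

lemma foldFreq_le_abs {n m : ℕ} (h : m ≤ n) (l : ℤ) : foldFreq n m ≤ |(m : ℝ) + l * n| := by
  have hm : (m : ℝ) ≤ n := by exact_mod_cast h
  have hm0 : (0 : ℝ) ≤ m := by positivity
  rcases le_or_gt 0 l with hl | hl
  · have : (0 : ℝ) ≤ l := by exact_mod_cast hl
    have : 0 ≤ (l : ℝ) * n := by positivity
    exact (min_le_left _ _).trans ((by linarith : (m : ℝ) ≤ m + l * n).trans (le_abs_self _))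
  · have : (l : ℝ) ≤ -1 := by exact_mod_cast (by omega : l ≤ -1)
    have : (l : ℝ) * n ≤ -1 * n := by gcongr
    exact (min_le_right _ _).trans
      ((by linarith : (n : ℝ) - m ≤ -(m + l * n)).trans (neg_le_abs _))

lemma foldFreq_sq_le {n m : ℕ} (h : m ≤ n) (l : ℤ) :
    foldFreq n m ^ 2 ≤ ((m : ℝ) + l * n) ^ 2 := by
  rw [← sq_abs ((m : ℝ) + l * n)]
  have := foldFreq_nonneg h
  gcongr
  exact foldFreq_le_abs h l

/-- The smallest aliased frequency is attained, at `l = 0` or `l = -1`. -/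
lemma exists_foldFreq_sq_eq (n m : ℕ) :
    ∃ l : ℤ, ((m : ℝ) + l * n) ^ 2 = foldFreq n m ^ 2 := by
  rcases min_choice (m : ℝ) ((n : ℝ) - m) with h | h
  · exact ⟨0, by simp [foldFreq, h]⟩
  · refine ⟨-1, ?_⟩
    rw [foldFreq, h]; push_cast; ring

/-- Aliased frequencies grow linearly in `l`, uniformly in `n` and relative to the folded
frequency. -/
lemma one_add_foldFreq_sq_mul_le {n m : ℕ} (hn : 1 ≤ n) (h : m ≤ n) (l : ℤ) :
    (1 + foldFreq n m ^ 2) * (1 + (l : ℝ) ^ 2) ≤ 9 * (1 + ((m : ℝ) + l * n) ^ 2) := by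
  have hm : (m : ℝ) ≤ n := by exact_mod_cast h
  have hn' : (1 : ℝ) ≤ n := by exact_mod_cast hn
  have hm0 : (0 : ℝ) ≤ m := by positivity
  have hq := foldFreq_nonneg h
  have hqn := foldFreq_le h
  rcases le_or_gt 0 l with hl | hl
  · have hl' : (0 : ℝ) ≤ l := by exact_mod_cast hl
    have hq1 : foldFreq n m ≤ m := min_le_left _ _
    have := one_add_sq_mul_le (j := (m : ℝ) + l * n) hq hl' (by nlinarith) (by nlinarith)
      (by nlinarith)
    nlinarith [sq_nonneg ((m : ℝ) + l * n)]
  · have hl' : (l : ℝ) ≤ -1 := by exact_mod_cast (by omega : l ≤ -1)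
    have hq1 : foldFreq n m ≤ n - m := min_le_right _ _
    have := one_add_sq_mul_le (l := -(l : ℝ) - 1) (j := -((m : ℝ) + l * n)) hq (by linarith)
      (by nlinarith) (by nlinarith) (by nlinarith)
    have h3 : 1 + (l : ℝ) ^ 2 ≤ 3 * (1 + (-(l : ℝ) - 1) ^ 2) := by
      nlinarith [sq_nonneg (2 * (l : ℝ) + 3)]
    have h4 : (1 + foldFreq n m ^ 2) * (1 + (l : ℝ) ^ 2) ≤
        (1 + foldFreq n m ^ 2) * (3 * (1 + (-(l : ℝ) - 1) ^ 2)) := by gcongr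
    nlinarith

lemma summable_one_add_int_sq_rpow {s : ℝ} (hs : 1 / 2 < s) :
    Summable fun l : ℤ => (1 + (l : ℝ) ^ 2) ^ (-s) := by
  have h := ((Real.summable_one_div_int_add_rpow (1 / 2) (2 * s)).2 (by linarith)).mul_left
    ((2 : ℝ) ^ s)
  refine h.of_nonneg_of_le (fun l => by positivity) fun l => ?_
  have hpos : 0 < |(l : ℝ) + 1 / 2| := by
    rw [abs_pos]
    intro h0
    have : (2 * l + 1 : ℤ) = 0 := by
      have : (2 : ℝ) * l + 1 = 0 := by linarith
      exact_mod_cast this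
    omega
  have e1 : (2 : ℝ) ^ s * (1 / |(l : ℝ) + 1 / 2| ^ (2 * s))
      = (|(l : ℝ) + 1 / 2| ^ 2 / 2) ^ (-s) := by
    rw [Real.rpow_neg (by positivity), Real.div_rpow (by positivity) (by norm_num),
      Real.rpow_mul (by positivity), Real.rpow_two]
    field_simp
  rw [e1]
  refine Real.rpow_le_rpow_of_nonpos (by positivity) ?_ (by linarith)
  rw [sq_abs]
  nlinarith [sq_nonneg ((l : ℝ) - 1 / 2)]

lemma min_one_sq_mul_le {α x : ℝ} (hx : 0 ≤ x) : min 1 (α ^ 2) * (1 + x) ≤ α ^ 2 + x := by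
  have h1 := min_le_left 1 (α ^ 2)
  have h2 := min_le_right 1 (α ^ 2)
  nlinarith

lemma summable_aliasSum {s α : ℝ} {n m : ℕ} (hs : 1 / 2 < s) (hα : 0 < α) (hn : 1 ≤ n)
    (h : m ≤ n) : Summable fun l : ℤ => (α ^ 2 + ((m : ℝ) + l * n) ^ 2) ^ (-s) := by
  have hc : 0 < min 1 (α ^ 2) / 9 := by positivity
  refine ((summable_one_add_int_sq_rpow hs).mul_left ((min 1 (α ^ 2) / 9) ^ (-s))).of_nonneg_of_le
    (fun l => by positivity) fun l => ?_
  rw [← Real.mul_rpow hc.le (by positivity)]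
  refine Real.rpow_le_rpow_of_nonpos (by positivity) ?_ (by linarith)
  refine le_trans ?_ (min_one_sq_mul_le (sq_nonneg _))
  have h1 := one_add_foldFreq_sq_mul_le hn h l
  have h2 : 1 + (l : ℝ) ^ 2 ≤ 9 * (1 + ((m : ℝ) + l * n) ^ 2) := by
    nlinarith [sq_nonneg (foldFreq n m), sq_nonneg (l : ℝ),
      mul_nonneg (sq_nonneg (foldFreq n m)) (sq_nonneg (l : ℝ))]
  have h3 : (0 : ℝ) < min 1 (α ^ 2) := by positivity
  rw [div_mul_eq_mul_div, div_le_iff₀ (by norm_num)]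
  nlinarith

lemma aliasSum_pos {s α : ℝ} {n m : ℕ} (hs : 1 / 2 < s) (hα : 0 < α) (hn : 1 ≤ n)
    (h : m ≤ n) : 0 < aliasSum s α n m :=
  (summable_aliasSum hs hα hn h).tsum_pos (fun l => by positivity) 0 (by positivity)

/-! ### Dependence of the aliased spectrum on the range and on the regularity -/

lemma rpow_neg_le_exp_mul {s α α' b q x : ℝ} (hs : 0 < s) (hα : 0 < α) (hα' : 0 < α')
    (hb : α' ≤ b) (hx : q ^ 2 ≤ x) :
    (α ^ 2 + x) ^ (-s) ≤ Real.exp (s * (b ^ 2 / (α ^ 2 + q ^ 2))) * (α' ^ 2 + x) ^ (-s) := by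
  have hx0 : 0 ≤ x := (sq_nonneg q).trans hx
  have h1 : α' ^ 2 + x ≤ Real.exp (b ^ 2 / (α ^ 2 + q ^ 2)) * (α ^ 2 + x) := by
    have h2 : 1 + b ^ 2 / (α ^ 2 + q ^ 2) ≤ Real.exp (b ^ 2 / (α ^ 2 + q ^ 2)) := by
      linarith [Real.add_one_le_exp (b ^ 2 / (α ^ 2 + q ^ 2))]
    refine le_trans ?_ (mul_le_mul_of_nonneg_right h2 (by positivity))
    have h3 : b ^ 2 ≤ b ^ 2 / (α ^ 2 + q ^ 2) * (α ^ 2 + x) := by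
      rw [div_mul_eq_mul_div, le_div_iff₀ (by positivity)]
      gcongr
    have h4 : α' ^ 2 ≤ b ^ 2 := by gcongr
    nlinarith [sq_nonneg α]
  have h5 : (Real.exp (b ^ 2 / (α ^ 2 + q ^ 2)) * (α ^ 2 + x)) ^ (-s) ≤ (α' ^ 2 + x) ^ (-s) :=
    Real.rpow_le_rpow_of_nonpos (by positivity) h1 (by linarith)
  rw [Real.mul_rpow (by positivity) (by positivity), ← Real.exp_mul] at h5
  calc (α ^ 2 + x) ^ (-s)
      = Real.exp (s * (b ^ 2 / (α ^ 2 + q ^ 2))) *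
          (Real.exp (b ^ 2 / (α ^ 2 + q ^ 2) * -s) * (α ^ 2 + x) ^ (-s)) := by
        rw [← mul_assoc, ← Real.exp_add,
          show s * (b ^ 2 / (α ^ 2 + q ^ 2)) + b ^ 2 / (α ^ 2 + q ^ 2) * -s = 0 by ring,
          Real.exp_zero, one_mul]
    _ ≤ _ := by gcongr

lemma log_aliasSum_le {s α α' b : ℝ} {n m : ℕ} (hs : 1 / 2 < s) (hα : 0 < α) (hα' : 0 < α')
    (hb : α' ≤ b) (hn : 1 ≤ n) (h : m ≤ n) :
    Real.log (aliasSum s α n m) ≤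
      Real.log (aliasSum s α' n m) + s * (b ^ 2 / (α ^ 2 + foldFreq n m ^ 2)) := by
  have h1 : aliasSum s α n m ≤
      Real.exp (s * (b ^ 2 / (α ^ 2 + foldFreq n m ^ 2))) * aliasSum s α' n m := by
    rw [aliasSum, aliasSum, ← tsum_mul_left]
    exact (summable_aliasSum hs hα hn h).tsum_le_tsum
      (fun l => rpow_neg_le_exp_mul (by linarith) hα hα' hb (foldFreq_sq_le h l))
      ((summable_aliasSum hs hα' hn h).mul_left _)
  have h2 := Real.log_le_log (aliasSum_pos hs hα hn h) h1
  rw [Real.log_mul (Real.exp_pos _).ne' (aliasSum_pos hs hα' hn h).ne', Real.log_exp] at h2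
  linarith

/-- The range parameter is felt only at low frequencies: on a compact set of ranges it changes the
logarithm of the spectrum by `O(1 / (1 + q²))`. -/
lemma abs_log_aliasSum_sub_le {s S α α' a b : ℝ} {n m : ℕ} (hs : 1 / 2 < s) (hS : s ≤ S)
    (ha : 0 < a) (haα : a ≤ α) (haα' : a ≤ α') (hαb : α ≤ b) (hαb' : α' ≤ b)
    (hn : 1 ≤ n) (h : m ≤ n) :
    |Real.log (aliasSum s α n m) - Real.log (aliasSum s α' n m)| ≤
      S * b ^ 2 * (1 + (a ^ 2)⁻¹) / (1 + foldFreq n m ^ 2) := by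
  have key : ∀ β, a ≤ β → s * (b ^ 2 / (β ^ 2 + foldFreq n m ^ 2)) ≤
      S * b ^ 2 * (1 + (a ^ 2)⁻¹) / (1 + foldFreq n m ^ 2) := by
    intro β hβ
    have h1 : 1 + foldFreq n m ^ 2 ≤ (1 + (a ^ 2)⁻¹) * (β ^ 2 + foldFreq n m ^ 2) := by
      have h2 : a ^ 2 ≤ β ^ 2 := by gcongr
      have h3 : (a ^ 2)⁻¹ * a ^ 2 ≤ (a ^ 2)⁻¹ * β ^ 2 := by gcongr
      rw [inv_mul_cancel₀ (by positivity)] at h3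
      have h4 : 0 ≤ (a ^ 2)⁻¹ * foldFreq n m ^ 2 := by positivity
      nlinarith [sq_nonneg β]
    have hβ0 : 0 < β := ha.trans_le hβ
    rw [le_div_iff₀ (by positivity), mul_assoc, div_mul_eq_mul_div, mul_div_assoc', div_le_iff₀
      (by positivity)]
    have h5 : 0 < s := by linarith
    have h6 : 0 < S := by linarith
    calc s * (b ^ 2 * (1 + foldFreq n m ^ 2))
        ≤ S * (b ^ 2 * ((1 + (a ^ 2)⁻¹) * (β ^ 2 + foldFreq n m ^ 2))) := by gcongr
      _ = _ := by ring
  have hα : 0 < α := ha.trans_le haα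
  have hα' : 0 < α' := ha.trans_le haα'
  rw [abs_le]
  constructor
  · have := log_aliasSum_le (b := b) hs hα' hα hαb hn h
    linarith [key α' haα']
  · have := log_aliasSum_le (b := b) hs hα hα' hαb' hn h
    linarith [key α haα]

lemma rpow_sub_rpow_le {x s t η : ℝ} (hx : 0 < x) (hx1 : x ≤ 1) (hη : 0 < η)
    {σ : ℝ} (hσ : σ ≤ s - η) (hst : s ≤ t) :
    x ^ s - x ^ t ≤ (t - s) / η * x ^ σ := by
  have h1 : x ^ t = x ^ s * x ^ (t - s) := by rw [← Real.rpow_add hx]; ring_nf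
  have h2 : 1 + (t - s) * Real.log x ≤ x ^ (t - s) := by
    rw [Real.rpow_def_of_pos hx]
    linarith [Real.add_one_le_exp (Real.log x * (t - s))]
  have h3 : -Real.log x ≤ x ^ (-η) / η := by
    have := Real.log_le_rpow_div (inv_nonneg.2 hx.le) hη
    rwa [Real.log_inv, Real.inv_rpow hx.le, ← Real.rpow_neg hx.le] at this
  have h4 : x ^ s * x ^ (-η) ≤ x ^ σ := by
    rw [← Real.rpow_add hx]
    exact Real.rpow_le_rpow_of_exponent_ge hx hx1 (by linarith)
  have h0 : 0 < x ^ s := by positivity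
  calc x ^ s - x ^ t = x ^ s * (1 - x ^ (t - s)) := by rw [h1]; ring
    _ ≤ x ^ s * ((t - s) * (x ^ (-η) / η)) := by
        gcongr
        have := mul_le_mul_of_nonneg_left h3 (sub_nonneg.2 hst)
        linarith
    _ = (t - s) / η * (x ^ s * x ^ (-η)) := by ring
    _ ≤ _ := by
        have : 0 ≤ (t - s) / η := div_nonneg (sub_nonneg.2 hst) hη.le
        gcongr

lemma exp_logAliasRemainder {s : ℝ} {n m : ℕ} (hs : 1 / 2 < s) (hn : 1 ≤ n) (h : m ≤ n) :
    HasSum (fun l : ℤ => ((1 + foldFreq n m ^ 2) / (1 + ((m : ℝ) + l * n) ^ 2)) ^ s)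
      (Real.exp (logAliasRemainder n m s)) := by
  have h1 := (summable_aliasSum hs one_pos hn h).hasSum.mul_left ((1 + foldFreq n m ^ 2) ^ s)
  rw [logAliasRemainder, Real.exp_add, Real.exp_log (aliasSum_pos hs one_pos hn h), mul_comm s,
    Real.exp_mul, Real.exp_log (by positivity), mul_comm]
  refine h1.congr_fun ?_
  intro l
  rw [Real.div_rpow (by positivity) (by positivity), Real.rpow_neg (by positivity), one_pow]
  rfl

/-- The remainder `logAliasRemainder` is Lipschitz in the exponent, uniformly in the frequency and
in the grid size. -/
lemma exists_lipschitz_logAliasRemainder {s₀ : ℝ} (hs₀ : 1 / 2 < s₀) :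
    ∃ C : ℝ, 0 ≤ C ∧ ∀ n m : ℕ, 1 ≤ n → m ≤ n → ∀ s t : ℝ, s₀ ≤ s → s₀ ≤ t →
      |logAliasRemainder n m s - logAliasRemainder n m t| ≤ C * |s - t| := by
  set η := (s₀ - 1 / 2) / 2 with hη
  have hη0 : 0 < η := by linarith
  have hσ : 1 / 2 < s₀ - η := by linarith
  set A := ∑' l : ℤ, (9 : ℝ) ^ (s₀ - η) * (1 + (l : ℝ) ^ 2) ^ (-(s₀ - η)) with hA
  have hsumA := (summable_one_add_int_sq_rpow hσ).mul_left ((9 : ℝ) ^ (s₀ - η))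
  have hA0 : 0 ≤ A := tsum_nonneg fun l => by positivity
  refine ⟨A / η, by positivity, fun n m hn h => ?_⟩
  have key : ∀ s t : ℝ, s₀ ≤ s → s ≤ t →
      |logAliasRemainder n m s - logAliasRemainder n m t| ≤ A / η * (t - s) := by
    intro s t hs hst
    have Hs := exp_logAliasRemainder (hs₀.trans_le hs) hn h
    have Ht := exp_logAliasRemainder (hs₀.trans_le (hs.trans hst)) hn h
    set ρ : ℤ → ℝ := fun l => (1 + foldFreq n m ^ 2) / (1 + ((m : ℝ) + l * n) ^ 2) with hρ
    have hρ0 : ∀ l, 0 < ρ l := fun l => by simp only [hρ]; positivity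
    have hρ1 : ∀ l, ρ l ≤ 1 := fun l => by
      simp only [hρ]
      rw [div_le_one (by positivity)]
      linarith [foldFreq_sq_le h l]
    have hρ9 : ∀ l, ρ l ≤ 9 * (1 + (l : ℝ) ^ 2)⁻¹ := fun l => by
      simp only [hρ]
      rw [div_le_iff₀ (by positivity), ← div_eq_mul_inv, div_mul_eq_mul_div,
        le_div_iff₀ (by positivity)]
      exact one_add_foldFreq_sq_mul_le hn h l
    obtain ⟨l₀, hl₀⟩ := exists_foldFreq_sq_eq n m
    have hone : ρ l₀ = 1 := by
      simp only [hρ]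
      rw [hl₀, div_self (by positivity)]
    have hge1 : 1 ≤ Real.exp (logAliasRemainder n m t) := by
      have : ρ l₀ ^ t ≤ _ := le_hasSum Ht l₀ (fun l _ => (Real.rpow_pos_of_pos (hρ0 l) t).le)
      rwa [hone, Real.one_rpow] at this
    have hmono : Real.exp (logAliasRemainder n m t) ≤ Real.exp (logAliasRemainder n m s) :=
      hasSum_le (fun l => Real.rpow_le_rpow_of_exponent_ge (hρ0 l) (hρ1 l) hst) Ht Hs
    have hdiff : Real.exp (logAliasRemainder n m s) - Real.exp (logAliasRemainder n m t)
        ≤ (t - s) / η * A := by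
      refine hasSum_le (fun l => ?_) (Hs.sub Ht) (hsumA.hasSum.mul_left ((t - s) / η))
      refine (rpow_sub_rpow_le (hρ0 l) (hρ1 l) hη0 (σ := s₀ - η) (by linarith) hst).trans ?_
      have : 0 ≤ (t - s) / η := div_nonneg (sub_nonneg.2 hst) hη0.le
      gcongr
      rw [Real.rpow_neg (by positivity), ← Real.inv_rpow (by positivity),
        ← Real.mul_rpow (by norm_num) (by positivity)]
      have := hρ0 l
      gcongr
      exact hρ9 l
    have hle := Real.exp_le_exp.1 hmono
    rw [abs_of_nonneg (by linarith)]
    have h5 := Real.add_one_le_exp (logAliasRemainder n m s - logAliasRemainder n m t)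
    rw [Real.exp_sub] at h5
    have h6 : Real.exp (logAliasRemainder n m s) / Real.exp (logAliasRemainder n m t) - 1 ≤
        Real.exp (logAliasRemainder n m s) - Real.exp (logAliasRemainder n m t) := by
      rw [div_sub_one (by positivity), div_le_iff₀ (by positivity)]
      nlinarith
    calc _ ≤ (t - s) / η * A := by linarith
      _ = _ := by ring
  intro s t hs ht
  rcases le_total s t with hst | hst
  · rw [abs_sub_comm s t, abs_of_nonneg (sub_nonneg.2 hst)]
    exact key s t hs hst
  · rw [abs_sub_comm (logAliasRemainder n m s), abs_of_nonneg (sub_nonneg.2 hst)]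
    exact key t s ht hst

/-! ### The Hartley transform diagonalises the covariance matrices -/

/-- The eigenvalue of `maternCovMatrix θ n` at frequency `m`. -/
noncomputable def maternEigenvalue (θ : MaternParam) (n m : ℕ) : ℝ :=
  n * θ.phi * aliasSum (θ.nu + 1 / 2) θ.alpha n m

/-- The discrete Hartley transform: the real, symmetric and orthogonal analogue of the discrete
Fourier transform, with entries `(cos x + sin x) / √n` at `x = 2πma/n`. -/
noncomputable def hartley (n : ℕ) : Matrix (Fin n) (Fin n) ℝ :=
  Matrix.of fun m a => (Real.cos (2 * Real.pi * ((m : ℝ) * a / n)) +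
    Real.sin (2 * Real.pi * ((m : ℝ) * a / n))) / √n

lemma hartley_isSymm (n : ℕ) : (hartley n)ᵀ = hartley n := by
  ext m a
  simp [hartley, mul_comm]

lemma hartley_mul_hartley_apply {n : ℕ} (a b m : Fin n) :
    hartley n a m * hartley n m b = (n : ℝ)⁻¹ *
      (Real.cos (2 * Real.pi * ((m : ℝ) * ((a : ℝ) - b) / n)) +
        Real.sin (2 * Real.pi * ((m : ℝ) * ((a : ℝ) + b) / n))) := by
  have h1 : 2 * Real.pi * ((m : ℝ) * ((a : ℝ) - b) / n) =
      2 * Real.pi * ((a : ℝ) * m / n) - 2 * Real.pi * ((m : ℝ) * b / n) := by ring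
  have h2 : 2 * Real.pi * ((m : ℝ) * ((a : ℝ) + b) / n) =
      2 * Real.pi * ((a : ℝ) * m / n) + 2 * Real.pi * ((m : ℝ) * b / n) := by ring
  rw [h1, h2, Real.cos_sub, Real.sin_add]
  simp only [hartley, Matrix.of_apply]
  rw [div_mul_div_comm, Real.mul_self_sqrt (by positivity)]
  ring

lemma sum_exp_eq {n : ℕ} (hn : 1 ≤ n) (k : ℤ) :
    ∑ m : Fin n, Complex.exp (2 * Real.pi * Complex.I * (k / n)) ^ (m : ℕ) =
      if (n : ℤ) ∣ k then (n : ℂ) else 0 := by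
  have hn0 : (n : ℂ) ≠ 0 := by exact_mod_cast (by omega : n ≠ 0)
  rw [Fin.sum_univ_eq_sum_range fun m => Complex.exp (2 * Real.pi * Complex.I * (k / n)) ^ m]
  split_ifs with h
  · obtain ⟨l, rfl⟩ := h
    have : Complex.exp (2 * Real.pi * Complex.I * ((n * l : ℤ) / n)) = 1 := by
      rw [Complex.exp_eq_one_iff]
      exact ⟨l, by push_cast; field_simp⟩
    simp only [this, one_pow]
    simp
  · have h1 : Complex.exp (2 * Real.pi * Complex.I * (k / n)) ≠ 1 := by
      rw [Ne, Complex.exp_eq_one_iff]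
      rintro ⟨l, hl⟩
      apply h
      refine ⟨l, ?_⟩
      have h2 : 2 * Real.pi * Complex.I ≠ 0 := by simp [Real.pi_ne_zero, Complex.I_ne_zero]
      rw [mul_comm (l : ℂ)] at hl
      have h3 := mul_left_cancel₀ h2 hl
      rw [div_eq_iff hn0] at h3
      have h4 : k = l * n := by exact_mod_cast h3
      rw [h4, mul_comm]
    rw [geom_sum_eq h1, ← Complex.exp_nat_mul]
    have : Complex.exp (n * (2 * Real.pi * Complex.I * (k / n))) = 1 := by
      rw [Complex.exp_eq_one_iff]
      exact ⟨k, by field_simp⟩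
    rw [this]; simp

lemma exp_pow_eq {n : ℕ} (k : ℤ) (m : ℕ) :
    Complex.exp (2 * Real.pi * Complex.I * (k / n)) ^ m =
      (Real.cos (2 * Real.pi * ((m : ℝ) * k / n)) : ℂ) +
        (Real.sin (2 * Real.pi * ((m : ℝ) * k / n)) : ℂ) * Complex.I := by
  rw [← Complex.exp_nat_mul, Complex.ofReal_cos, Complex.ofReal_sin, ← Complex.exp_mul_I]
  congr 1
  push_cast
  ring

lemma sum_cos_eq {n : ℕ} (hn : 1 ≤ n) (k : ℤ) :
    ∑ m : Fin n, Real.cos (2 * Real.pi * ((m : ℝ) * k / n)) =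
      if (n : ℤ) ∣ k then (n : ℝ) else 0 := by
  have h := congrArg Complex.re (sum_exp_eq hn k)
  simp only [exp_pow_eq, Complex.re_sum] at h
  simp only [Complex.add_re, Complex.ofReal_re, Complex.mul_re, Complex.I_re, Complex.ofReal_im,
    Complex.I_im, mul_zero, zero_mul, sub_zero, add_zero] at h
  rw [h]; split_ifs <;> simp

lemma sum_sin_eq_zero {n : ℕ} (hn : 1 ≤ n) (k : ℤ) :
    ∑ m : Fin n, Real.sin (2 * Real.pi * ((m : ℝ) * k / n)) = 0 := by
  have h := congrArg Complex.im (sum_exp_eq hn k)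
  simp only [exp_pow_eq, Complex.im_sum] at h
  simp only [Complex.add_im, Complex.ofReal_re, Complex.mul_im, Complex.I_re, Complex.ofReal_im,
    Complex.I_im, mul_zero, mul_one, zero_add, add_zero] at h
  rw [h]; split_ifs <;> simp

lemma hartley_mul_self {n : ℕ} (hn : 1 ≤ n) : hartley n * hartley n = 1 := by
  ext a b
  rw [Matrix.mul_apply]
  simp only [hartley_mul_hartley_apply]
  rw [← Finset.mul_sum, Finset.sum_add_distrib]
  have h1 := sum_cos_eq hn ((a : ℤ) - b)
  have h2 := sum_sin_eq_zero hn ((a : ℤ) + b)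
  push_cast at h1 h2
  rw [h1, h2, add_zero, Matrix.one_apply]
  have hn0 : (n : ℝ) ≠ 0 := by exact_mod_cast (by omega : n ≠ 0)
  by_cases hab : a = b
  · simp [hab, hn0]
  · rw [if_neg hab, if_neg, mul_zero]
    intro hd
    have := Int.eq_zero_of_abs_lt_dvd hd (by rw [abs_lt]; omega)
    apply hab; ext; omega

lemma summable_maternCoeff {θ : MaternParam} (hν : 0 < θ.nu) (hα : 0 < θ.alpha) :
    Summable (maternCoeff θ) := by
  have := (summable_aliasSum (s := θ.nu + 1 / 2) (n := 1) (m := 0) (by linarith) hα le_rfl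
    (by norm_num)).mul_left θ.phi
  refine this.congr fun j => ?_
  rw [Real.rpow_neg (by positivity)]
  simp [maternCoeff, div_eq_mul_inv]

lemma maternCoeff_nonneg {θ : MaternParam} (hφ : 0 < θ.phi) (j : ℤ) : 0 ≤ maternCoeff θ j := by
  unfold maternCoeff; positivity

lemma maternKernel_eq {θ : MaternParam} (hν : 0 < θ.nu) (hφ : 0 < θ.phi) (hα : 0 < θ.alpha)
    (x : ℝ) : maternKernel θ x = ∑' j : ℤ, maternCoeff θ j * Real.cos (2 * Real.pi * (j * x)) := by
  have hs := summable_maternCoeff hν hα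
  have e : ∀ j : ℤ, Complex.exp (2 * Real.pi * Complex.I * x * j) =
      Complex.exp ((2 * Real.pi * (j * x) : ℝ) * Complex.I) := fun j => by
    congr 1; push_cast; ring
  rw [maternKernel, Complex.re_tsum]
  · refine tsum_congr fun j => ?_
    rw [e, Complex.re_ofReal_mul, Complex.exp_ofReal_mul_I_re]
  · refine Summable.of_norm (hs.congr fun j => ?_)
    rw [e, norm_mul, Complex.norm_exp_ofReal_mul_I, mul_one, Complex.norm_real, Real.norm_eq_abs,
      abs_of_nonneg (maternCoeff_nonneg hφ j)]

lemma tsum_maternCoeff_mul_sin (θ : MaternParam) (x : ℝ) :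
    ∑' j : ℤ, maternCoeff θ j * Real.sin (2 * Real.pi * (j * x)) = 0 := by
  have h := (Equiv.neg ℤ).tsum_eq fun j : ℤ => maternCoeff θ j * Real.sin (2 * Real.pi * (j * x))
  have h2 : ∀ j : ℤ, maternCoeff θ (-j) * Real.sin (2 * Real.pi * ((-j : ℤ) * x)) =
      -(maternCoeff θ j * Real.sin (2 * Real.pi * (j * x))) := fun j => by
    rw [show 2 * Real.pi * (((-j : ℤ) : ℝ) * x) = -(2 * Real.pi * (j * x)) by push_cast; ring,
      Real.sin_neg]
    simp [maternCoeff]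
  simp only [Equiv.neg_apply, h2, tsum_neg] at h
  linarith

lemma summable_maternCoeff_mul {θ : MaternParam} (hν : 0 < θ.nu) (hφ : 0 < θ.phi)
    (hα : 0 < θ.alpha) {g : ℤ → ℝ} (hg : ∀ j, |g j| ≤ 1) :
    Summable fun j => maternCoeff θ j * g j := by
  refine Summable.of_norm_bounded (summable_maternCoeff hν hα) fun j => ?_
  rw [norm_mul, Real.norm_eq_abs, Real.norm_eq_abs, abs_of_nonneg (maternCoeff_nonneg hφ j)]
  exact mul_le_of_le_one_right (maternCoeff_nonneg hφ j) (hg j)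

/-- The Fourier term of the Hartley-diagonalised kernel depends on the frequency `l n + m` only
through `m`, apart from its coefficient. -/
lemma maternCoeff_mul_aliased (θ : MaternParam) {n : ℕ} (hn : 1 ≤ n) (a b m : ℕ) (l : ℤ) :
    maternCoeff θ (l * n + m) *
        Real.cos (2 * Real.pi * (((l * n + m : ℤ) : ℝ) * ((a : ℝ) / n - b / n))) +
      maternCoeff θ (l * n + m) *
        Real.sin (2 * Real.pi * (((l * n + m : ℤ) : ℝ) * ((a : ℝ) / n + b / n))) =
    (θ.phi * (Real.cos (2 * Real.pi * ((m : ℝ) * ((a : ℝ) - b) / n)) +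
      Real.sin (2 * Real.pi * ((m : ℝ) * ((a : ℝ) + b) / n)))) *
        (θ.alpha ^ 2 + ((m : ℝ) + l * n) ^ 2) ^ (-(θ.nu + 1 / 2)) := by
  have hn0 : (n : ℝ) ≠ 0 := by exact_mod_cast (by omega : n ≠ 0)
  have c1 : 2 * Real.pi * (((l * n + m : ℤ) : ℝ) * ((a : ℝ) / n - b / n)) =
      2 * Real.pi * ((m : ℝ) * ((a : ℝ) - b) / n) + ((l * (a - b) : ℤ) : ℝ) * (2 * Real.pi) := by
    push_cast; field_simp; ring
  have c2 : 2 * Real.pi * (((l * n + m : ℤ) : ℝ) * ((a : ℝ) / n + b / n)) =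
      2 * Real.pi * ((m : ℝ) * ((a : ℝ) + b) / n) + ((l * (a + b) : ℤ) : ℝ) * (2 * Real.pi) := by
    push_cast; field_simp; ring
  have c3 : maternCoeff θ (l * n + m) =
      θ.phi * (θ.alpha ^ 2 + ((m : ℝ) + l * n) ^ 2) ^ (-(θ.nu + 1 / 2)) := by
    rw [maternCoeff, Real.rpow_neg (by positivity), div_eq_mul_inv]
    push_cast
    rw [show (l : ℝ) * n + m = m + l * n by ring]
  rw [c1, c2, c3, Real.cos_add_int_mul_two_pi, Real.sin_add_int_mul_two_pi]
  ring

lemma maternKernel_eq_tsum_add {θ : MaternParam} (hν : 0 < θ.nu) (hφ : 0 < θ.phi)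
    (hα : 0 < θ.alpha) (x y : ℝ) :
    Summable (fun j : ℤ => maternCoeff θ j * Real.cos (2 * Real.pi * (j * x)) +
      maternCoeff θ j * Real.sin (2 * Real.pi * (j * y))) ∧
    maternKernel θ x = ∑' j : ℤ, (maternCoeff θ j * Real.cos (2 * Real.pi * (j * x)) +
      maternCoeff θ j * Real.sin (2 * Real.pi * (j * y))) := by
  have hs1 : Summable fun j : ℤ => maternCoeff θ j * Real.cos (2 * Real.pi * (j * x)) :=
    summable_maternCoeff_mul hν hφ hα fun j => Real.abs_cos_le_one _
  have hs2 : Summable fun j : ℤ => maternCoeff θ j * Real.sin (2 * Real.pi * (j * y)) :=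
    summable_maternCoeff_mul hν hφ hα fun j => Real.abs_sin_le_one _
  refine ⟨hs1.add hs2, ?_⟩
  rw [hs1.tsum_add hs2, tsum_maternCoeff_mul_sin, add_zero, maternKernel_eq hν hφ hα]

lemma tsum_int_eq_sum_fin {f : ℤ → ℝ} (hf : Summable f) (n : ℕ) [NeZero n] :
    ∑' j, f j = ∑ m : Fin n, ∑' l : ℤ, f (l * n + (m : ℕ)) := by
  have hprod : Summable fun p : ℤ × Fin n => f ((Int.divModEquiv n).symm p) :=
    (Int.divModEquiv n).symm.summable_iff.2 hf
  have hswap : Summable fun p : Fin n × ℤ => f ((Int.divModEquiv n).symm (p.2, p.1)) :=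
    (Equiv.prodComm (Fin n) ℤ).summable_iff.2 hprod
  have h2 : ∑' j, f j = ∑' p : Fin n × ℤ, f ((Int.divModEquiv n).symm (p.2, p.1)) := by
    rw [← (Int.divModEquiv n).symm.tsum_eq f]
    exact ((Equiv.prodComm (Fin n) ℤ).tsum_eq
      fun p : ℤ × Fin n => f ((Int.divModEquiv n).symm p)).symm
  rw [h2, hswap.tsum_prod, tsum_fintype]
  rfl

lemma maternCovMatrix_eq {θ : MaternParam} (hν : 0 < θ.nu) (hφ : 0 < θ.phi) (hα : 0 < θ.alpha)
    {n : ℕ} (hn : 1 ≤ n) :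
    maternCovMatrix θ n =
      hartley n * Matrix.diagonal (fun m : Fin n => maternEigenvalue θ n m) * hartley n := by
  have : NeZero n := ⟨by omega⟩
  have hn0 : (n : ℝ) ≠ 0 := by exact_mod_cast (by omega : n ≠ 0)
  ext a b
  rw [Matrix.mul_apply]
  simp only [Matrix.mul_diagonal]
  obtain ⟨hs, he⟩ := maternKernel_eq_tsum_add hν hφ hα ((a : ℝ) / n - b / n) ((a : ℝ) / n + b / n)
  have h1 : maternCovMatrix θ n a b = maternKernel θ ((a : ℝ) / n - b / n) := rfl
  rw [h1, he, tsum_int_eq_sum_fin hs n]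
  refine Finset.sum_congr rfl fun m _ => ?_
  simp only [maternCoeff_mul_aliased θ hn]
  rw [tsum_mul_left, mul_right_comm (hartley n a m), hartley_mul_hartley_apply, maternEigenvalue,
    ← aliasSum]
  field_simp

lemma maternEigenvalue_pos {θ : MaternParam} (hν : 0 < θ.nu) (hφ : 0 < θ.phi) (hα : 0 < θ.alpha)
    {n m : ℕ} (hn : 1 ≤ n) (h : m ≤ n) : 0 < maternEigenvalue θ n m := by
  have := aliasSum_pos (s := θ.nu + 1 / 2) (by linarith) hα hn h
  have : (0 : ℝ) < n := by exact_mod_cast (by omega : 0 < n)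
  unfold maternEigenvalue
  positivity

/-- In the Hartley basis the likelihood decouples into one term for each frequency. -/
lemma negLogLik_eq {θ : MaternParam} (hν : 0 < θ.nu) (hφ : 0 < θ.phi) (hα : 0 < θ.alpha)
    {n : ℕ} (hn : 1 ≤ n) (z : Fin n → ℝ) :
    negLogLik n z θ = (n : ℝ)⁻¹ * ∑ m : Fin n, (Real.log (maternEigenvalue θ n m) +
      (hartley n *ᵥ z) m ^ 2 / maternEigenvalue θ n m) := by
  have hpos : ∀ m : Fin n, 0 < maternEigenvalue θ n m := fun m =>
    maternEigenvalue_pos hν hφ hα hn m.2.le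
  have hH := hartley_mul_self hn
  have hK := maternCovMatrix_eq hν hφ hα hn
  have hdet : (maternCovMatrix θ n).det = ∏ m : Fin n, maternEigenvalue θ n m := by
    have h1 : (hartley n).det * (hartley n).det = 1 := by rw [← Matrix.det_mul, hH, Matrix.det_one]
    rw [hK, Matrix.det_mul, Matrix.det_mul, Matrix.det_diagonal]
    linear_combination (∏ m : Fin n, maternEigenvalue θ n m) * h1
  have hinv : (maternCovMatrix θ n)⁻¹ = hartley n *
      Matrix.diagonal (fun m : Fin n => (maternEigenvalue θ n m)⁻¹) * hartley n := by
    refine Matrix.inv_eq_right_inv ?_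
    rw [hK]
    calc _ = hartley n * Matrix.diagonal (fun m : Fin n => maternEigenvalue θ n m) *
          (hartley n * hartley n) * Matrix.diagonal (fun m : Fin n => (maternEigenvalue θ n m)⁻¹) *
          hartley n := by simp only [Matrix.mul_assoc]
      _ = hartley n * (Matrix.diagonal (fun m : Fin n => maternEigenvalue θ n m) *
          Matrix.diagonal (fun m : Fin n => (maternEigenvalue θ n m)⁻¹)) * hartley n := by
        rw [hH, Matrix.mul_one]; simp only [Matrix.mul_assoc]
      _ = 1 := by
        rw [Matrix.diagonal_mul_diagonal]
        simp [(hpos _).ne', hH]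
  have hquad : z ⬝ᵥ ((maternCovMatrix θ n)⁻¹ *ᵥ z) =
      ∑ m : Fin n, (hartley n *ᵥ z) m ^ 2 / maternEigenvalue θ n m := by
    rw [hinv, ← Matrix.mulVec_mulVec, ← Matrix.mulVec_mulVec, Matrix.dotProduct_mulVec,
      ← Matrix.mulVec_transpose, hartley_isSymm, dotProduct]
    refine Finset.sum_congr rfl fun m _ => ?_
    rw [Matrix.mulVec_diagonal]
    ring
  rw [negLogLik, hdet, hquad, Real.log_prod (fun m _ => (hpos m).ne'), Finset.sum_add_distrib]

/-! ### The normalised periodogram -/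

/-- The squared Hartley coefficients of the data, divided by their variances under `θ`. If `θ` is
the true parameter, these are the squares of independent standard Gaussian variables. -/
noncomputable def periodogram (θ : MaternParam) (n : ℕ) (z : Fin n → ℝ) (m : Fin n) : ℝ :=
  (hartley n *ᵥ z) m ^ 2 / maternEigenvalue θ n m

lemma periodogram_nonneg {θ : MaternParam} (hν : 0 < θ.nu) (hφ : 0 < θ.phi) (hα : 0 < θ.alpha)
    {n : ℕ} (hn : 1 ≤ n) (z : Fin n → ℝ) (m : Fin n) : 0 ≤ periodogram θ n z m :=
  div_nonneg (sq_nonneg _) (maternEigenvalue_pos hν hφ hα hn m.2.le).le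

section Gaussian

variable {Ω : Type*} [MeasurableSpace Ω] {P : Measure Ω} {ξ : ℝ → Ω → ℝ} {θ : MaternParam}

lemma div_mem_Icc {n : ℕ} (a : Fin n) : ((a : ℕ) : ℝ) / n ∈ Icc (0 : ℝ) 1 := by
  have : ((a : ℕ) : ℝ) ≤ n := by exact_mod_cast a.2.le
  exact ⟨by positivity, div_le_one_of_le₀ this (by positivity)⟩

lemma IsMaternProcess.hasGaussianLaw_hartley (hξ : IsMaternProcess ξ θ P) (n : ℕ) :
    HasGaussianLaw (fun ω => hartley n *ᵥ gridData (fun x => ξ x ω) n) P := by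
  have h1 := hξ.gaussian.comp_right fun a : Fin n => (⟨(a : ℝ) / n, div_mem_Icc a⟩ : Icc (0 : ℝ) 1)
  let L : (↥(Finset.univ : Finset (Fin n)) → ℝ) →L[ℝ] (Fin n → ℝ) :=
    LinearMap.toContinuousLinearMap
      ((hartley n).mulVecLin ∘ₗ LinearMap.funLeft ℝ ℝ fun a : Fin n => ⟨a, Finset.mem_univ a⟩)
  exact (h1.hasGaussianLaw Finset.univ).map L

lemma IsMaternProcess.covariance_hartley (hξ : IsMaternProcess ξ θ P) (hν : 0 < θ.nu)
    (hφ : 0 < θ.phi) (hα : 0 < θ.alpha) {n : ℕ} (hn : 1 ≤ n) (i j : Fin n) :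
    covariance (fun ω => (hartley n *ᵥ gridData (fun x => ξ x ω) n) i)
      (fun ω => (hartley n *ᵥ gridData (fun x => ξ x ω) n) j) P =
      if i = j then maternEigenvalue θ n i else 0 := by
  have := hξ.gaussian.isProbabilityMeasure
  have hL2 : ∀ a : Fin n, MemLp (fun ω => ξ ((a : ℝ) / n) ω) 2 P := fun a =>
    (hξ.gaussian.hasGaussianLaw_eval ⟨(a : ℝ) / n, div_mem_Icc a⟩).memLp_two
  have hH := hartley_mul_self hn
  have hdiag : hartley n * maternCovMatrix θ n * hartley n =
      Matrix.diagonal (fun m : Fin n => maternEigenvalue θ n m) := by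
    rw [maternCovMatrix_eq hν hφ hα hn]
    calc _ = (hartley n * hartley n) * Matrix.diagonal (fun m : Fin n => maternEigenvalue θ n m) *
          (hartley n * hartley n) := by simp only [Matrix.mul_assoc]
      _ = _ := by rw [hH, Matrix.one_mul, Matrix.mul_one]
  simp only [Matrix.mulVec, dotProduct, gridData]
  rw [covariance_fun_sum_fun_sum (fun a => (hL2 a).const_mul _) (fun a => (hL2 a).const_mul _)]
  have hij := congrFun (congrFun hdiag i) j
  rw [Matrix.diagonal_apply] at hij
  rw [← hij, Matrix.mul_apply, Finset.sum_comm]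
  refine Finset.sum_congr rfl fun b _ => ?_
  rw [Matrix.mul_apply, Finset.sum_mul]
  refine Finset.sum_congr rfl fun a _ => ?_
  rw [covariance_const_mul_left, covariance_const_mul_right,
    hξ.cov_eq _ (div_mem_Icc a) _ (div_mem_Icc b)]
  have e : hartley n b j = hartley n j b := congrFun (congrFun (hartley_isSymm n) j) b
  rw [e, maternCovMatrix, Matrix.of_apply]
  ring

lemma IsMaternProcess.integral_hartley (hξ : IsMaternProcess ξ θ P) (n : ℕ) (i : Fin n) :
    ∫ ω, (hartley n *ᵥ gridData (fun x => ξ x ω) n) i ∂P = 0 := by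
  simp only [Matrix.mulVec, dotProduct, gridData]
  rw [integral_finsetSum _ fun (a : Fin n) _ =>
    ((hξ.gaussian.hasGaussianLaw_eval ⟨(a : ℝ) / n, div_mem_Icc a⟩).integrable).const_mul _]
  refine Finset.sum_eq_zero fun a _ => ?_
  rw [integral_const_mul, hξ.centered _ (div_mem_Icc a), mul_zero]

/-- The normalised Hartley coefficients are independent standard Gaussian variables. -/
lemma IsMaternProcess.standardised_hartley (hξ : IsMaternProcess ξ θ P) (hν : 0 < θ.nu)
    (hφ : 0 < θ.phi) (hα : 0 < θ.alpha) {n : ℕ} (hn : 1 ≤ n) :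
    iIndepFun (fun (i : Fin n) ω => (hartley n *ᵥ gridData (fun x => ξ x ω) n) i) P ∧
    ∀ i : Fin n, P.map (fun ω => (hartley n *ᵥ gridData (fun x => ξ x ω) n) i /
      √(maternEigenvalue θ n i)) = gaussianReal 0 1 := by
  have hG := hξ.hasGaussianLaw_hartley n
  have hcov := hξ.covariance_hartley hν hφ hα hn
  refine ⟨hG.iIndepFun_of_covariance_eq_zero fun i j hij => by rw [hcov, if_neg hij], fun i => ?_⟩
  have hpos := maternEigenvalue_pos hν hφ hα hn i.2.le
  have h1 := hG.eval i
  have hm := h1.map_eq_gaussianReal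
  rw [hξ.integral_hartley, ← covariance_self h1.aemeasurable, hcov, if_pos rfl] at hm
  have h2 := gaussianReal_map_div_const (μ := 0) (v := (maternEigenvalue θ n i).toNNReal)
    (√(maternEigenvalue θ n i))
  rw [← hm, AEMeasurable.map_map_of_aemeasurable (by fun_prop) h1.aemeasurable] at h2
  refine (Eq.trans ?_ h2).trans ?_
  · rfl
  · congr 1
    · simp
    · ext
      simp [Real.sq_sqrt hpos.le, hpos.le, hpos.ne']

lemma memLp_sq_gaussianReal : MemLp (fun x : ℝ => x ^ 2) 2 (gaussianReal 0 1) := by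
  have h := memLp_id_gaussianReal' (μ := 0) (v := 1) 4 (by simp)
  have h2 := h.norm_rpow_div 2
  have e : (4 : ENNReal) / 2 = 2 := by
    rw [show (4 : ENNReal) = 2 * 2 by norm_num, ENNReal.mul_div_cancel_right (by simp) (by simp)]
  rw [e] at h2
  refine h2.congr_norm (by fun_prop) (Eventually.of_forall fun x => ?_)
  simp

lemma integral_sq_gaussianReal : ∫ x, x ^ 2 ∂(gaussianReal 0 1) = 1 := by
  have h := variance_id_gaussianReal (μ := 0) (v := 1)
  rw [variance_of_integral_eq_zero (by fun_prop) (by simp)] at h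
  simpa using h

/-- The entries of the normalised periodogram are independent copies of the square of a standard
Gaussian variable. -/
lemma IsMaternProcess.periodogram_moments (hξ : IsMaternProcess ξ θ P) (hν : 0 < θ.nu)
    (hφ : 0 < θ.phi) (hα : 0 < θ.alpha) {n : ℕ} (hn : 1 ≤ n) :
    (∀ m, MemLp (fun ω => periodogram θ n (gridData (fun x => ξ x ω) n) m) 2 P) ∧
    (∀ m, ∫ ω, periodogram θ n (gridData (fun x => ξ x ω) n) m ∂P = 1) ∧
    (∀ m, variance (fun ω => periodogram θ n (gridData (fun x => ξ x ω) n) m) P =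
      variance (fun x : ℝ => x ^ 2) (gaussianReal 0 1)) ∧
    iIndepFun (fun m ω => periodogram θ n (gridData (fun x => ξ x ω) n) m) P := by
  obtain ⟨hind, hlaw⟩ := hξ.standardised_hartley hν hφ hα hn
  have haem : ∀ m : Fin n, AEMeasurable (fun ω => (hartley n *ᵥ gridData (fun x => ξ x ω) n) m /
      √(maternEigenvalue θ n m)) P := fun m =>
    ((hξ.hasGaussianLaw_hartley n).eval m).aemeasurable.div_const _
  have he : ∀ m : Fin n, (fun ω => periodogram θ n (gridData (fun x => ξ x ω) n) m) =
      (fun x : ℝ => x ^ 2) ∘ fun ω => (hartley n *ᵥ gridData (fun x => ξ x ω) n) m /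
        √(maternEigenvalue θ n m) := fun m => by
    ext ω
    simp [periodogram, div_pow, Real.sq_sqrt (maternEigenvalue_pos hν hφ hα hn m.2.le).le]
  refine ⟨fun m => ?_, fun m => ?_, fun m => ?_, ?_⟩
  · rw [he m, ← memLp_map_measure_iff (by fun_prop) (haem m), hlaw m]
    exact memLp_sq_gaussianReal
  · have h := integral_map (haem m) (f := fun x : ℝ => x ^ 2) (by fun_prop)
    rw [hlaw m, integral_sq_gaussianReal] at h
    rw [h]
    exact integral_congr_ae (Eventually.of_forall fun ω => congrFun (he m) ω)
  · rw [he m, ← variance_map (by fun_prop) (haem m), hlaw m]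
  · exact hind.comp (fun m y => y ^ 2 / maternEigenvalue θ n m) fun m => by fun_prop

end Gaussian

lemma integral_abs_le_sqrt_variance {Ω : Type*} [MeasurableSpace Ω] {P : Measure Ω}
    [IsProbabilityMeasure P] {X : Ω → ℝ} (hX : MemLp X 2 P) (h0 : ∫ ω, X ω ∂P = 0) :
    ∫ ω, |X ω| ∂P ≤ √(variance X P) := by
  apply Real.le_sqrt_of_sq_le
  have h1 := variance_nonneg |X| P
  rw [variance_eq_sub hX.abs] at h1
  rw [variance_of_integral_eq_zero hX.aemeasurable h0]
  simp only [Pi.pow_apply, Pi.abs_apply, sq_abs] at h1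
  linarith

/-- Weighted averages of the centred periodogram are small in `L¹`. -/
lemma integral_abs_sum_centred_le {Ω : Type*} [MeasurableSpace Ω] {P : Measure Ω}
    [IsProbabilityMeasure P] {ι : Type*} [Fintype ι] {U : ι → Ω → ℝ} {V : ℝ}
    (hL2 : ∀ m, MemLp (U m) 2 P) (hmean : ∀ m, ∫ ω, U m ω ∂P = 1)
    (hvar : ∀ m, variance (U m) P = V) (hind : iIndepFun U P) (a : ι → ℝ) :
    ∫ ω, |∑ m, a m * (U m ω - 1)| ∂P ≤ √(V * ∑ m, a m ^ 2) := by
  have hL2' : ∀ m, MemLp (fun ω => a m * (U m ω - 1)) 2 P := fun m =>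
    ((hL2 m).sub (memLp_const 1)).const_mul _
  have hsum : (fun ω => ∑ m, a m * (U m ω - 1)) = ∑ m, fun ω => a m * (U m ω - 1) := by
    ext ω; simp
  refine (integral_abs_le_sqrt_variance (memLp_finsetSum _ fun m _ => hL2' m) ?_).trans ?_
  · rw [integral_finsetSum _ fun m _ => (hL2' m).integrable one_le_two]
    refine Finset.sum_eq_zero fun m _ => ?_
    rw [integral_const_mul, integral_sub ((hL2 m).integrable one_le_two) (integrable_const 1),
      hmean m]
    simp
  · apply Real.sqrt_le_sqrt
    rw [hsum, IndepFun.variance_sum (fun m _ => hL2' m), Finset.mul_sum]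
    · refine Finset.sum_le_sum fun m _ => ?_
      rw [variance_const_mul, variance_sub_const (hL2 m).1, hvar m]
      exact le_of_eq (mul_comm _ _)
    · intro i _ j _ hij
      exact (hind.indepFun hij).comp (φ := fun x => a i * (x - 1)) (ψ := fun x => a j * (x - 1))
        (by fun_prop) (by fun_prop)

/-! ### Averages and a quantitative Jensen inequality -/

/-- The average of a function on `Fin n`. -/
noncomputable def avg {n : ℕ} (f : Fin n → ℝ) : ℝ := (n : ℝ)⁻¹ * ∑ m, f m

section avg

variable {n : ℕ} {f g : Fin n → ℝ}

lemma avg_add (f g : Fin n → ℝ) : avg (fun m => f m + g m) = avg f + avg g := by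
  simp only [avg, Finset.sum_add_distrib, mul_add]

lemma avg_sub (f g : Fin n → ℝ) : avg (fun m => f m - g m) = avg f - avg g := by
  simp only [avg, Finset.sum_sub_distrib, mul_sub]

lemma avg_const_mul (c : ℝ) (f : Fin n → ℝ) : avg (fun m => c * f m) = c * avg f := by
  simp only [avg, ← Finset.mul_sum]; ring

lemma avg_const (hn : 1 ≤ n) (c : ℝ) : avg (fun _ : Fin n => c) = c := by
  have hn0 : (n : ℝ) ≠ 0 := by exact_mod_cast (by omega : n ≠ 0)
  simp [avg, hn0]

lemma avg_mono (h : ∀ m, f m ≤ g m) : avg f ≤ avg g :=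
  mul_le_mul_of_nonneg_left (Finset.sum_le_sum fun m _ => h m) (by positivity)

lemma avg_nonneg (h : ∀ m, 0 ≤ f m) : 0 ≤ avg f :=
  mul_nonneg (by positivity) (Finset.sum_nonneg fun m _ => h m)

lemma abs_avg_le : |avg f| ≤ avg fun m => |f m| := by
  rw [avg, abs_mul, abs_of_nonneg (by positivity : (0 : ℝ) ≤ (n : ℝ)⁻¹)]
  exact mul_le_mul_of_nonneg_left (Finset.abs_sum_le_sum_abs _ _) (by positivity)

lemma abs_avg_le_of_le {c : ℝ} (hn : 1 ≤ n) (h : ∀ m, |f m| ≤ c) : |avg f| ≤ c :=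
  abs_avg_le.trans ((avg_mono h).trans_eq (avg_const hn c))

end avg

lemma sq_div_four_le_exp_sub {u x : ℝ} (h0 : 0 ≤ u) (h1 : u ≤ 1) (hx : u ≤ |x|) :
    u ^ 2 / 4 ≤ Real.exp x - 1 - x := by
  rcases le_or_gt 0 x with h | h
  · rw [abs_of_nonneg h] at hx
    nlinarith [Real.quadratic_le_exp_of_nonneg h]
  · rw [abs_of_neg h] at hx
    have e1 : 1 - u + u ^ 2 / 4 ≤ Real.exp (-u) := by
      have h2 : 1 - u / 2 ≤ Real.exp (-(u / 2)) := by linarith [Real.add_one_le_exp (-(u / 2))]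
      have h3 : Real.exp (-u) = Real.exp (-(u / 2)) * Real.exp (-(u / 2)) := by
        rw [← Real.exp_add]; ring_nf
      nlinarith
    have e2 : Real.exp (-u) ≤ 1 := Real.exp_le_one_iff.2 (by linarith)
    have e3 : Real.exp (-u) * (1 + (x + u)) ≤ Real.exp x := by
      have h4 : Real.exp x = Real.exp (-u) * Real.exp (x + u) := by
        rw [← Real.exp_add]; ring_nf
      rw [h4]
      exact mul_le_mul_of_nonneg_left (by linarith [Real.add_one_le_exp (x + u)])
        (Real.exp_pos _).le
    nlinarith

/-- Quantitative Jensen inequality: if two blocks of weight at least `p` carry values of `r` that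
are at least `v` apart, then the Jensen gap of `r` is at least of order `p v²`. -/
lemma log_sum_mul_exp_ge {ι : Type*} [Fintype ι] {w r : ι → ℝ} (hw : ∀ m, 0 ≤ w m)
    (hw1 : ∑ m, w m = 1) {A B : Finset ι} {p v : ℝ} (hp : 0 ≤ p) (hp1 : p ≤ 1)
    (hA : p ≤ ∑ m ∈ A, w m) (hB : p ≤ ∑ m ∈ B, w m) (hv : 0 ≤ v) (hv1 : v ≤ 1)
    (hsep : ∀ a ∈ A, ∀ b ∈ B, v ≤ |r a - r b|) :
    ∑ m, w m * r m + p * v ^ 2 / 32 ≤ Real.log (∑ m, w m * Real.exp (r m)) := by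
  classical
  set τ := ∑ m, w m * r m with hτ
  have hφ : ∀ x : ℝ, 0 ≤ Real.exp x - 1 - x := fun x => by linarith [Real.add_one_le_exp x]
  have key : ∀ C : Finset ι, p ≤ ∑ m ∈ C, w m → (∀ m ∈ C, v / 2 ≤ |r m - τ|) →
      p * v ^ 2 / 16 ≤ ∑ m, w m * (Real.exp (r m - τ) - 1 - (r m - τ)) := by
    intro C hC hCv
    calc p * v ^ 2 / 16 = p * ((v / 2) ^ 2 / 4) := by ring
      _ ≤ (∑ m ∈ C, w m) * ((v / 2) ^ 2 / 4) := by gcongr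
      _ = ∑ m ∈ C, w m * ((v / 2) ^ 2 / 4) := by rw [Finset.sum_mul]
      _ ≤ ∑ m ∈ C, w m * (Real.exp (r m - τ) - 1 - (r m - τ)) :=
          Finset.sum_le_sum fun m hm => mul_le_mul_of_nonneg_left
            (sq_div_four_le_exp_sub (by linarith) (by linarith) (hCv m hm)) (hw m)
      _ ≤ _ := Finset.sum_le_univ_sum_of_nonneg fun m => mul_nonneg (hw m) (hφ _)
  -- The mean `τ` cannot be within `v / 2` of a value on each of the two blocks.
  have hgap : p * v ^ 2 / 16 ≤ ∑ m, w m * (Real.exp (r m - τ) - 1 - (r m - τ)) := by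
    by_cases h : ∀ m ∈ A, v / 2 ≤ |r m - τ|
    · exact key A hA h
    · push Not at h
      obtain ⟨a, ha, hav⟩ := h
      refine key B hB fun b hb => ?_
      have h1 := hsep a ha b hb
      have h2 := abs_sub_le (r a) τ (r b)
      rw [abs_sub_comm τ] at h2
      linarith
  have hsum : ∑ m, w m * Real.exp (r m) = Real.exp τ *
      (1 + ∑ m, w m * (Real.exp (r m - τ) - 1 - (r m - τ))) := by
    have h1 : ∑ m, w m * (Real.exp (r m - τ) - 1 - (r m - τ)) =
        ∑ m, w m * Real.exp (r m - τ) - 1 := by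
      have h2 : ∀ m, w m * (Real.exp (r m - τ) - 1 - (r m - τ)) =
          w m * Real.exp (r m - τ) - w m - (w m * r m - w m * τ) := fun m => by ring
      simp only [h2, Finset.sum_sub_distrib, ← Finset.sum_mul, hw1, ← hτ]
      ring
    rw [h1, add_sub_cancel, Finset.mul_sum]
    refine Finset.sum_congr rfl fun m _ => ?_
    rw [Real.exp_sub]
    field_simp
  have hy0 : 0 ≤ p * v ^ 2 / 16 := by positivity
  have hy1 : p * v ^ 2 / 16 ≤ 1 := by
    have : p * v ^ 2 ≤ 1 * 1 ^ 2 := by gcongr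
    linarith
  have hlog : p * v ^ 2 / 32 ≤ Real.log (1 + p * v ^ 2 / 16) := by
    refine le_trans ?_ (Real.le_log_one_add_of_nonneg hy0)
    rw [le_div_iff₀ (by linarith)]
    nlinarith
  rw [hsum, Real.log_mul (Real.exp_pos _).ne' (by linarith), Real.log_exp]
  have := Real.log_le_log (by linarith) (add_le_add_right hgap 1)
  linarith

lemma avg_exp_mul_pos {n : ℕ} {U : Fin n → ℝ} (hU : ∀ m, 0 ≤ U m) (h : 0 < avg U)
    (r : Fin n → ℝ) : 0 < avg fun m => Real.exp (r m) * U m := by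
  have hn : (0 : ℝ) < (n : ℝ)⁻¹ := by
    refine (by positivity : (0 : ℝ) ≤ (n : ℝ)⁻¹).lt_of_ne' fun h0 => ?_
    rw [avg, h0, zero_mul] at h
    exact h.false
  have h1 : ∃ m, 0 < U m := by
    by_contra! hcon
    have : ∑ m, U m ≤ 0 := Finset.sum_nonpos fun m _ => hcon m
    rw [avg] at h
    nlinarith
  obtain ⟨m, hm⟩ := h1
  exact mul_pos hn (Finset.sum_pos' (fun i _ => mul_nonneg (Real.exp_pos _).le (hU i))
    ⟨m, Finset.mem_univ m, mul_pos (Real.exp_pos _) hm⟩)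

lemma exp_sub_one_le {x y κ : ℝ} (h : |x| ≤ y) (hy : y ≤ κ) :
    |Real.exp x - 1| ≤ y * Real.exp κ := by
  have hy0 : 0 ≤ y := (abs_nonneg x).trans h
  have hx := abs_le.1 h
  have h1 : Real.exp x ≤ Real.exp κ := Real.exp_le_exp.2 (by linarith)
  have h2 : 1 ≤ Real.exp κ := Real.one_le_exp (by linarith)
  have h3 := Real.add_one_le_exp x
  have h4 : Real.exp x * (1 - x) ≤ 1 := by
    have := Real.add_one_le_exp (-x)
    have h5 : Real.exp x * Real.exp (-x) = 1 := by rw [← Real.exp_add]; simp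
    nlinarith [Real.exp_pos x]
  rw [abs_le]
  constructor
  · nlinarith
  · have h6 : Real.exp x * x ≤ Real.exp κ * y := by
      calc Real.exp x * x ≤ Real.exp x * y := by
            exact mul_le_mul_of_nonneg_left hx.2 (Real.exp_pos x).le
        _ ≤ _ := by gcongr
    linarith

/-- If the profile objective at log-ratios `r` does not exceed the one at log-ratios `r₁` that
are negligible except at low frequencies, then values of `r` on two blocks of frequencies cannot be
far apart. Here `d` is the part of `r` that carries the dependence on the regularity, and `g`
bounds the low-frequency errors. -/
lemma sq_separation_le {n : ℕ} (hn : 1 ≤ n) {U r r₁ d g : Fin n → ℝ} {κ D p v : ℝ}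
    (hU : ∀ m, 0 ≤ U m) (hmean : |avg U - 1| ≤ 1 / 2)
    (hg0 : ∀ m, 0 ≤ g m) (hg1 : ∀ m, g m ≤ 1) (hκ : 0 ≤ κ)
    (hrd : ∀ m, |r m - d m| ≤ κ * g m) (hr₁ : ∀ m, |r₁ m| ≤ κ * g m) (hd : ∀ m, |d m| ≤ D)
    {A B : Finset (Fin n)} (hp : 0 ≤ p) (hA : p ≤ (n : ℝ)⁻¹ * ∑ m ∈ A, U m)
    (hB : p ≤ (n : ℝ)⁻¹ * ∑ m ∈ B, U m) (hv : 0 ≤ v) (hv1 : v ≤ 1)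
    (hsep : ∀ a ∈ A, ∀ b ∈ B, v ≤ |r a - r b|)
    (hprof : Real.log (avg fun m => Real.exp (r m) * U m) - avg r ≤
      Real.log (avg fun m => Real.exp (r₁ m) * U m) - avg r₁) :
    p * v ^ 2 / 48 ≤ 4 * κ * Real.exp κ * avg (fun m => g m * U m) + 2 * κ * avg g +
      2 * |avg fun m => (U m - 1) * d m| + 2 * D * |avg U - 1| := by
  have hn0 : (0 : ℝ) < n := by exact_mod_cast (by omega : 0 < n)
  obtain ⟨hm1, hm2⟩ := abs_le.1 hmean
  set u := avg U with hu
  have hu0 : 1 / 2 ≤ u := by linarith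
  have hupos : 0 < u := by linarith
  have hG0 : 0 ≤ avg (fun m => g m * U m) := avg_nonneg fun m => mul_nonneg (hg0 m) (hU m)
  set G := avg (fun m => g m * U m) with hG
  -- The empirical weights `w = U / ∑ U`.
  have hw : ∀ f : Fin n → ℝ, ∑ m, (n : ℝ)⁻¹ * u⁻¹ * U m * f m = u⁻¹ * avg fun m => U m * f m := by
    intro f
    rw [avg, Finset.mul_sum, Finset.mul_sum]
    exact Finset.sum_congr rfl fun m _ => by ring
  have hw1 : ∑ m, (n : ℝ)⁻¹ * u⁻¹ * U m = 1 := by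
    have := hw fun _ => 1
    simp only [mul_one] at this
    rw [this, ← hu, inv_mul_cancel₀ hupos.ne']
  have hblock : ∀ C : Finset (Fin n), p ≤ (n : ℝ)⁻¹ * ∑ m ∈ C, U m →
      2 * p / 3 ≤ ∑ m ∈ C, (n : ℝ)⁻¹ * u⁻¹ * U m := by
    intro C hC
    have h1 : ∑ m ∈ C, (n : ℝ)⁻¹ * u⁻¹ * U m = ((n : ℝ)⁻¹ * ∑ m ∈ C, U m) / u := by
      rw [← Finset.mul_sum]; field_simp
    rw [h1, le_div_iff₀ hupos]
    nlinarith
  have hp1 : 2 * p / 3 ≤ 1 := by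
    have h1 := hblock A hA
    have h2 : ∑ m ∈ A, (n : ℝ)⁻¹ * u⁻¹ * U m ≤ ∑ m, (n : ℝ)⁻¹ * u⁻¹ * U m :=
      Finset.sum_le_univ_sum_of_nonneg fun m => by have := hU m; positivity
    linarith
  have hlow := log_sum_mul_exp_ge (w := fun m => (n : ℝ)⁻¹ * u⁻¹ * U m) (r := r)
    (fun m => by have := hU m; positivity) hw1 (by positivity) hp1 (hblock A hA) (hblock B hB)
    hv hv1 hsep
  rw [hw, hw] at hlow
  -- The benchmark objective is close to the objective at zero log-ratio.
  have hup : avg (fun m => Real.exp (r₁ m) * U m) ≤ u + κ * Real.exp κ * G := by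
    rw [hu, hG, ← avg_const_mul, ← avg_add]
    refine avg_mono fun m => ?_
    have h1 := (abs_le.1 (exp_sub_one_le (hr₁ m) (mul_le_of_le_one_right hκ (hg1 m)))).2
    have := mul_le_mul_of_nonneg_right h1 (hU m)
    linarith
  have hQpos : 0 < avg (fun m => Real.exp (r₁ m) * U m) := avg_exp_mul_pos hU hupos r₁
  have hlogup : Real.log (avg fun m => Real.exp (r₁ m) * U m) ≤
      Real.log u + 2 * (κ * Real.exp κ * G) := by
    have h1 := Real.log_le_sub_one_of_pos (div_pos hQpos hupos)
    rw [Real.log_div hQpos.ne' hupos.ne'] at h1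
    have h2 : avg (fun m => Real.exp (r₁ m) * U m) / u - 1 ≤ 2 * (κ * Real.exp κ * G) := by
      rw [div_sub_one hupos.ne', div_le_iff₀ hupos]
      have : 0 ≤ κ * Real.exp κ * G := by positivity
      nlinarith
    linarith
  have hlowlog : Real.log (u⁻¹ * avg fun m => U m * Real.exp (r m)) =
      Real.log (avg fun m => Real.exp (r m) * U m) - Real.log u := by
    have h1 : 0 < avg fun m => Real.exp (r m) * U m := avg_exp_mul_pos hU hupos r
    simp only [mul_comm (U _)]
    rw [Real.log_mul (by positivity) h1.ne', Real.log_inv]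
    ring
  rw [hlowlog] at hlow
  have hr₁avg : -avg r₁ ≤ κ * avg g := by
    have h1 : |avg r₁| ≤ κ * avg g := by
      rw [← avg_const_mul]
      exact abs_avg_le.trans (avg_mono hr₁)
    linarith [(abs_le.1 h1).1]
  have hravg : avg r ≤ avg d + κ * avg g := by
    rw [← avg_const_mul, ← avg_add]
    exact avg_mono fun m => by linarith [(abs_le.1 (hrd m)).2]
  have hUr : avg (fun m => U m * d m) - κ * G ≤ avg (fun m => U m * r m) := by
    rw [hG, ← avg_const_mul, ← avg_sub]
    refine avg_mono fun m => ?_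
    have := mul_le_mul_of_nonneg_left (abs_le.1 (hrd m)).1 (hU m)
    linarith
  have hdec : avg (fun m => U m * d m) = avg (fun m => (U m - 1) * d m) + avg d := by
    rw [← avg_add]; congr 1; ext m; ring
  have hdavg : |avg d| ≤ D := abs_avg_le_of_le hn hd
  have hDpos : 0 ≤ D := (abs_nonneg _).trans hdavg
  set N := avg fun m => (U m - 1) * d m with hN
  have huinv : u⁻¹ ≤ 2 := by
    rw [inv_le_comm₀ hupos (by norm_num)]; linarith
  have hmain : avg d - u⁻¹ * avg (fun m => U m * d m) ≤ 2 * |N| + 2 * D * |u - 1| := by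
    have h1 : avg d - u⁻¹ * avg (fun m => U m * d m) = u⁻¹ * ((u - 1) * avg d - N) := by
      rw [hdec]; field_simp; ring
    have h2 : (u - 1) * avg d - N ≤ |u - 1| * D + |N| := by
      have h3 : |(u - 1) * avg d| ≤ |u - 1| * D := by
        rw [abs_mul]; gcongr
      linarith [(abs_le.1 h3).2, neg_abs_le N]
    rw [h1]
    calc u⁻¹ * ((u - 1) * avg d - N) ≤ u⁻¹ * (|u - 1| * D + |N|) := by gcongr
      _ ≤ 2 * (|u - 1| * D + |N|) := by gcongr
      _ = _ := by ring
  have hUr' : u⁻¹ * avg (fun m => U m * d m) - 2 * (κ * G) ≤ u⁻¹ * avg (fun m => U m * r m) := by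
    have h1 := mul_le_mul_of_nonneg_left hUr (inv_nonneg.2 hupos.le)
    have h2 : u⁻¹ * (κ * G) ≤ 2 * (κ * G) := by gcongr
    linarith
  have hκe : κ * G ≤ κ * Real.exp κ * G := by
    have : 1 ≤ Real.exp κ := Real.one_le_exp hκ
    have : κ * 1 ≤ κ * Real.exp κ := by gcongr
    nlinarith
  have : p * v ^ 2 / 48 = 2 * p / 3 * v ^ 2 / 32 := by ring
  linarith

/-- A Lipschitz function is controlled by its increments over a grid and the mesh size. -/
lemma abs_sub_le_sum_increments {F : ℝ → ℝ} {a b M : ℝ} (hM : 0 ≤ M)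
    (hF : ∀ s t, a ≤ s → a ≤ t → |F s - F t| ≤ M * |s - t|) {N : ℕ} (hN : 1 ≤ N) {s : ℝ}
    (has : a ≤ s) (hsb : s ≤ b) :
    |F s - F a| ≤ ∑ i ∈ Finset.range N, |F (a + (i + 1 : ℕ) * ((b - a) / N)) -
      F (a + (i : ℕ) * ((b - a) / N))| + M * ((b - a) / N) := by
  have hN0 : (0 : ℝ) < N := by exact_mod_cast (by omega : 0 < N)
  set h := (b - a) / N with hh
  have hh0 : 0 ≤ h := div_nonneg (by linarith) hN0.le
  obtain ⟨k, hkN, hk⟩ : ∃ k : ℕ, k ≤ N ∧ |s - (a + k * h)| ≤ h := by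
    rcases hh0.eq_or_lt with h0 | hpos
    · have : b = a := by
        have : b - a = 0 := by
          rw [hh, eq_comm, div_eq_zero_iff] at h0
          exact h0.resolve_right hN0.ne'
        linarith
      exact ⟨0, by omega, by rw [← h0]; simp; linarith⟩
    · refine ⟨⌊(s - a) / h⌋₊, ?_, ?_⟩
      · apply Nat.floor_le_of_le
        rw [div_le_iff₀ hpos, hh, mul_div_cancel₀ _ hN0.ne']
        linarith
      · have h1 := Nat.floor_le (div_nonneg (sub_nonneg.2 has) hpos.le)
        have h2 := Nat.lt_floor_add_one ((s - a) / h)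
        rw [le_div_iff₀ hpos] at h1
        rw [div_lt_iff₀ hpos] at h2
        rw [abs_le]
        constructor <;> linarith
  have htel : F (a + k * h) - F a =
      ∑ i ∈ Finset.range k, (F (a + (i + 1 : ℕ) * h) - F (a + (i : ℕ) * h)) := by
    rw [Finset.sum_range_sub fun i : ℕ => F (a + (i : ℕ) * h)]
    simp
  have h1 : |F (a + k * h) - F a| ≤
      ∑ i ∈ Finset.range N, |F (a + (i + 1 : ℕ) * h) - F (a + (i : ℕ) * h)| := by
    rw [htel]
    refine (Finset.abs_sum_le_sum_abs _ _).trans ?_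
    exact Finset.sum_le_sum_of_subset_of_nonneg (Finset.range_mono hkN) fun _ _ _ => abs_nonneg _
  have hkh : 0 ≤ k * h := by positivity
  have h2 : |F s - F (a + k * h)| ≤ M * h :=
    (hF _ _ has (by linarith)).trans (mul_le_mul_of_nonneg_left hk hM)
  have h3 := abs_sub_le (F s) (F (a + k * h)) (F a)
  linarith

/-! ### The profile likelihood -/

/-- The logarithm of the ratio of the aliased spectra at `θ₀` and at `θ`, without amplitudes. -/
noncomputable def logRatio (θ₀ θ : MaternParam) (n : ℕ) (m : Fin n) : ℝ :=
  Real.log (aliasSum (θ₀.nu + 1 / 2) θ₀.alpha n m) - Real.log (aliasSum (θ.nu + 1 / 2) θ.alpha n m)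

lemma negLogLik_eq_logRatio {θ₀ θ : MaternParam} (hν₀ : 0 < θ₀.nu) (hφ₀ : 0 < θ₀.phi)
    (hα₀ : 0 < θ₀.alpha) (hν : 0 < θ.nu) (hφ : 0 < θ.phi) (hα : 0 < θ.alpha) {n : ℕ} (hn : 1 ≤ n)
    (z : Fin n → ℝ) :
    negLogLik n z θ =
      (Real.log n + avg fun m : Fin n => Real.log (aliasSum (θ₀.nu + 1 / 2) θ₀.alpha n m)) +
      Real.log θ.phi - avg (logRatio θ₀ θ n) +
      θ₀.phi / θ.phi * avg fun m => Real.exp (logRatio θ₀ θ n m) * periodogram θ₀ n z m := by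
  have hn0 : (0 : ℝ) < n := by exact_mod_cast (by omega : 0 < n)
  have hA₀ : ∀ m : Fin n, 0 < aliasSum (θ₀.nu + 1 / 2) θ₀.alpha n m := fun m =>
    aliasSum_pos (by linarith) hα₀ hn m.2.le
  have hA : ∀ m : Fin n, 0 < aliasSum (θ.nu + 1 / 2) θ.alpha n m := fun m =>
    aliasSum_pos (by linarith) hα hn m.2.le
  rw [negLogLik_eq hν hφ hα hn, ← avg_const hn (Real.log n), ← avg_add,
    ← avg_const hn (Real.log θ.phi), ← avg_add, ← avg_sub, ← avg_const_mul, ← avg_add]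
  rw [avg]
  congr 1
  refine Finset.sum_congr rfl fun m _ => ?_
  have h0 := hA₀ m
  have h1 := hA m
  rw [logRatio, periodogram, maternEigenvalue, maternEigenvalue]
  generalize aliasSum (θ₀.nu + 1 / 2) θ₀.alpha n m = a₀ at h0 ⊢
  generalize aliasSum (θ.nu + 1 / 2) θ.alpha n m = a at h1 ⊢
  rw [Real.log_mul (by positivity) h1.ne', Real.log_mul hn0.ne' hφ.ne', Real.exp_sub,
    Real.exp_log h0, Real.exp_log h1]
  field_simp
  ring

/-- The amplitude of a maximum likelihood estimate is the explicit minimiser at the estimated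
regularity and range, and these in turn minimise the profile likelihood. -/
lemma IsMLE.profile {θ₀ θ : MaternParam} (hν₀ : 0 < θ₀.nu) (hφ₀ : 0 < θ₀.phi) (hα₀ : 0 < θ₀.alpha)
    {N A : Set ℝ} (hN : ∀ ν ∈ N, 0 < ν) (hA : ∀ α ∈ A, 0 < α) {n : ℕ} (hn : 1 ≤ n) {z : Fin n → ℝ}
    (h : IsMLE (paramSet N A) n z θ) (hz : 0 < avg (periodogram θ₀ n z)) :
    θ.phi = θ₀.phi * avg (fun m => Real.exp (logRatio θ₀ θ n m) * periodogram θ₀ n z m) ∧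
    ∀ θ₁ ∈ paramSet N A,
      Real.log (avg fun m => Real.exp (logRatio θ₀ θ n m) * periodogram θ₀ n z m) -
        avg (logRatio θ₀ θ n) ≤
      Real.log (avg fun m => Real.exp (logRatio θ₀ θ₁ n m) * periodogram θ₀ n z m) -
        avg (logRatio θ₀ θ₁ n) := by
  obtain ⟨⟨hν, hφ, hα⟩, hmin⟩ := h
  have hU := periodogram_nonneg hν₀ hφ₀ hα₀ hn z
  have hQ : ∀ θ', 0 < avg fun m => Real.exp (logRatio θ₀ θ' n m) * periodogram θ₀ n z m :=
    fun θ' => avg_exp_mul_pos hU hz _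
  have key : ∀ θ₁ ∈ paramSet N A, Real.log θ.phi - avg (logRatio θ₀ θ n) +
      θ₀.phi / θ.phi * avg (fun m => Real.exp (logRatio θ₀ θ n m) * periodogram θ₀ n z m) ≤
      Real.log (θ₀.phi * avg fun m => Real.exp (logRatio θ₀ θ₁ n m) * periodogram θ₀ n z m) -
        avg (logRatio θ₀ θ₁ n) + 1 := by
    rintro θ₁ ⟨hν₁, hφ₁, hα₁⟩
    have hq := hQ θ₁
    have hφ₂ : 0 < θ₀.phi * avg fun m => Real.exp (logRatio θ₀ θ₁ n m) * periodogram θ₀ n z m := by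
      positivity
    let θ₂ : MaternParam := ⟨θ₁.nu,
      θ₀.phi * avg fun m => Real.exp (logRatio θ₀ θ₁ n m) * periodogram θ₀ n z m, θ₁.alpha⟩
    have h1 : negLogLik n z θ ≤ negLogLik n z θ₂ :=
      hmin (show θ₂ ∈ paramSet N A from ⟨hν₁, hφ₂, hα₁⟩)
    have h2 := negLogLik_eq_logRatio hν₀ hφ₀ hα₀ (θ := θ₂) (hN _ hν₁) hφ₂ (hA _ hα₁) hn z
    rw [h2, negLogLik_eq_logRatio hν₀ hφ₀ hα₀ (hN _ hν) hφ (hA _ hα) hn z] at h1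
    have h3 : logRatio θ₀ θ₂ n = logRatio θ₀ θ₁ n := rfl
    have h5 : θ₂.phi = θ₀.phi * avg fun m => Real.exp (logRatio θ₀ θ₁ n m) *
        periodogram θ₀ n z m := rfl
    have h4 : θ₀.phi / (θ₀.phi * avg fun m => Real.exp (logRatio θ₀ θ₁ n m) *
        periodogram θ₀ n z m) * avg (fun m => Real.exp (logRatio θ₀ θ₁ n m) *
        periodogram θ₀ n z m) = 1 := by
      field_simp
    rw [h3, h5, h4] at h1
    linarith
  have hq := hQ θ
  have hself := key θ ⟨hν, hφ, hα⟩
  rw [Real.log_mul hφ₀.ne' hq.ne'] at hself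
  have ht : θ₀.phi * avg (fun m => Real.exp (logRatio θ₀ θ n m) * periodogram θ₀ n z m) / θ.phi =
      1 := by
    by_contra hne
    have := Real.log_lt_sub_one_of_pos (by positivity) hne
    rw [Real.log_div (by positivity) hφ.ne', Real.log_mul hφ₀.ne' hq.ne'] at this
    rw [div_mul_eq_mul_div] at hself
    linarith
  have hphi : θ.phi =
      θ₀.phi * avg (fun m => Real.exp (logRatio θ₀ θ n m) * periodogram θ₀ n z m) := by
    rw [div_eq_one_iff_eq hφ.ne'] at ht
    exact ht.symm
  refine ⟨hphi, fun θ₁ hθ₁ => ?_⟩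
  have h1 := key θ₁ hθ₁
  have hq₁ := hQ θ₁
  rw [div_mul_eq_mul_div, ht, Real.log_mul hφ₀.ne' hq₁.ne'] at h1
  have h2 := congrArg Real.log hphi
  rw [Real.log_mul hφ₀.ne' hq.ne'] at h2
  linarith

/-! ### Blocks of frequencies -/

/-- The frequencies between `n / (2k)` and `n / k`. -/
def freqBlock (k n : ℕ) : Finset (Fin n) :=
  Finset.univ.filter fun m => n ≤ 2 * k * m ∧ k * m ≤ n

lemma le_card_freqBlock {k n : ℕ} (hk : 2 ≤ k) (hn : 4 * k ≤ n) :
    1 / (4 * k : ℝ) ≤ (n : ℝ)⁻¹ * (freqBlock k n).card := by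
  have hk0 : 0 < k := by omega
  have hn0 : 0 < n := by omega
  have hlt : ∀ m ∈ Finset.Icc (n / (2 * k) + 1) (n / k), m < n := by
    intro m hm
    have h1 := (Finset.mem_Icc.1 hm).2
    have h2 : n / k < n := Nat.div_lt_self hn0 (by omega)
    omega
  have hsub : (Finset.Icc (n / (2 * k) + 1) (n / k)).attachFin hlt ⊆ freqBlock k n := by
    intro m hm
    rw [Finset.mem_attachFin, Finset.mem_Icc] at hm
    simp only [freqBlock, Finset.mem_filter, Finset.mem_univ, true_and]
    constructor
    · have h1 := Nat.lt_mul_div_succ n (show 0 < 2 * k by omega)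
      have h2 : 2 * k * (n / (2 * k) + 1) ≤ 2 * k * m := Nat.mul_le_mul_left _ hm.1
      omega
    · exact (Nat.mul_le_mul_left k hm.2).trans (Nat.mul_div_le n k)
  have hcard := Finset.card_le_card hsub
  rw [Finset.card_attachFin, Nat.card_Icc, Nat.add_sub_add_right] at hcard
  have h1 : (n : ℝ) / k - 1 ≤ ((n / k : ℕ) : ℝ) := by
    rw [sub_le_iff_le_add, div_le_iff₀ (by positivity)]
    have := (Nat.lt_mul_div_succ n hk0).le
    have h : (n : ℝ) ≤ k * (((n / k : ℕ) : ℝ) + 1) := by exact_mod_cast this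
    linarith
  have h2 : ((n / (2 * k) : ℕ) : ℝ) ≤ n / (2 * k) := by
    have := @Nat.cast_div_le ℝ _ _ _ n (2 * k)
    push_cast at this
    exact this
  have h3 : ((n / k : ℕ) : ℝ) ≤ (freqBlock k n).card + ((n / (2 * k) : ℕ) : ℝ) := by
    exact_mod_cast Nat.sub_le_iff_le_add.1 hcard
  have h4 : (n : ℝ) / (2 * k) - 1 ≤ (freqBlock k n).card := by
    have : (n : ℝ) / k = n / (2 * k) + n / (2 * k) := by field_simp; norm_num
    linarith
  have h5 : (n : ℝ) / (4 * k) ≤ (freqBlock k n).card := by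
    have h6 : (1 : ℝ) ≤ n / (4 * k) := by
      rw [le_div_iff₀ (by positivity)]
      exact_mod_cast (by omega : 1 * (4 * k) ≤ n)
    have h7 : (n : ℝ) / (2 * k) = n / (4 * k) + n / (4 * k) := by field_simp; norm_num
    linarith
  have hn' : (0 : ℝ) < n := by exact_mod_cast hn0
  rw [inv_mul_eq_div, le_div_iff₀ hn', one_div_mul_eq_div]
  exact h5

lemma foldFreq_of_mem_freqBlock {k n : ℕ} (hk : 2 ≤ k) {m : Fin n} (hm : m ∈ freqBlock k n) :
    foldFreq n m = (m : ℝ) := by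
  simp only [freqBlock, Finset.mem_filter, Finset.mem_univ, true_and] at hm
  have h1 : 2 * (m : ℕ) ≤ n := (Nat.mul_le_mul_right _ hk).trans hm.2
  have h2 : 2 * ((m : ℕ) : ℝ) ≤ n := by exact_mod_cast h1
  exact min_eq_left (by linarith)

lemma inv_one_add_foldFreq_sq_le {k n : ℕ} (hk : 2 ≤ k) {m : Fin n}
    (hm : m ∈ freqBlock k n) : 1 / (1 + foldFreq n m ^ 2) ≤ 4 * k ^ 2 / (n : ℝ) ^ 2 := by
  rw [foldFreq_of_mem_freqBlock hk hm]
  simp only [freqBlock, Finset.mem_filter, Finset.mem_univ, true_and] at hm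
  have h1 : (n : ℝ) ≤ 2 * k * m := by exact_mod_cast hm.1
  have hn0 : (0 : ℝ) < n := by
    have := m.pos
    exact_mod_cast this
  rw [div_le_div_iff₀ (by positivity) (by positivity)]
  have : (n : ℝ) ^ 2 ≤ (2 * k * m) ^ 2 := by gcongr
  nlinarith [sq_nonneg (k : ℝ)]

/-- Frequencies in a low and a high block are far apart on the logarithmic scale. -/
lemma log_freq_separation {k n : ℕ} (hk : 2 ≤ k) {c : ℝ} (hc : Real.exp c ≤ k ^ 2 / 32)
    {a b : Fin n} (ha : a ∈ freqBlock k n) (hb : b ∈ freqBlock 2 n) :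
    c ≤ Real.log (1 + foldFreq n b ^ 2) - Real.log (1 + foldFreq n a ^ 2) := by
  rw [foldFreq_of_mem_freqBlock hk ha, foldFreq_of_mem_freqBlock le_rfl hb]
  simp only [freqBlock, Finset.mem_filter, Finset.mem_univ, true_and] at ha hb
  have hn0 : 0 < n := a.pos
  have ha1 : 1 ≤ (a : ℕ) := by
    by_contra h
    have : (a : ℕ) = 0 := by omega
    rw [this] at ha
    omega
  have ha1' : (1 : ℝ) ≤ (a : ℕ) := by exact_mod_cast ha1
  have ha2 : (k : ℝ) * (a : ℕ) ≤ n := by exact_mod_cast ha.2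
  have hb1 : (n : ℝ) ≤ 4 * (b : ℕ) := by exact_mod_cast (by omega : n ≤ 4 * (b : ℕ))
  rw [le_sub_iff_add_le, ← Real.log_exp c, ← Real.log_mul (Real.exp_pos c).ne' (by positivity)]
  apply Real.log_le_log (by positivity)
  have h1 : (k * (a : ℕ) : ℝ) ^ 2 ≤ (4 * (b : ℕ)) ^ 2 :=
    pow_le_pow_left₀ (by positivity) (ha2.trans hb1) 2
  calc Real.exp c * (1 + ((a : ℕ) : ℝ) ^ 2) ≤ k ^ 2 / 32 * (1 + ((a : ℕ) : ℝ) ^ 2) := by gcongr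
    _ ≤ k ^ 2 / 32 * (2 * ((a : ℕ) : ℝ) ^ 2) := by gcongr; nlinarith
    _ ≤ _ := by nlinarith

lemma exists_avg_inv_one_add_foldFreq_sq_le :
    ∃ C : ℝ, 0 ≤ C ∧ ∀ n : ℕ, avg (fun m : Fin n => 1 / (1 + foldFreq n m ^ 2)) ≤ C / n := by
  have hs : Summable fun m : ℕ => 1 / (1 + (m : ℝ) ^ 2) := by
    refine (summable_one_add_int_sq_rpow (s := 1) (by norm_num)).comp_injective
      Nat.cast_injective |>.congr fun m => ?_
    simp [Real.rpow_neg_one]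
  have h0 : ∀ m : ℕ, 0 ≤ 1 / (1 + (m : ℝ) ^ 2) := fun m => by positivity
  refine ⟨2 * ∑' m : ℕ, 1 / (1 + (m : ℝ) ^ 2), mul_nonneg zero_le_two (tsum_nonneg h0),
    fun n => ?_⟩
  rw [avg, div_eq_inv_mul]
  refine mul_le_mul_of_nonneg_left ?_ (by positivity)
  have hle : ∀ m : Fin n, 1 / (1 + foldFreq n m ^ 2) ≤
      1 / (1 + ((m : ℕ) : ℝ) ^ 2) + 1 / (1 + (((m.rev : Fin n) : ℕ) : ℝ) ^ 2) := by
    intro m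
    rcases min_choice ((m : ℕ) : ℝ) ((n : ℝ) - (m : ℕ)) with h | h
    · rw [foldFreq, h]
      linarith [h0 (m.rev : Fin n)]
    · rw [foldFreq, h]
      have h1 : 1 / (1 + ((n : ℝ) - (m : ℕ)) ^ 2) ≤ 1 / (1 + (((m.rev : Fin n) : ℕ) : ℝ) ^ 2) := by
        have h2 : (((m.rev : Fin n) : ℕ) : ℝ) ≤ (n : ℝ) - (m : ℕ) := by
          rw [le_sub_iff_add_le]
          have := m.2
          exact_mod_cast (by rw [Fin.val_rev]; omega : ((m.rev : Fin n) : ℕ) + m ≤ n)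
        gcongr
      linarith [h0 m]
  have hrange : ∑ m : Fin n, 1 / (1 + ((m : ℕ) : ℝ) ^ 2) ≤ ∑' m : ℕ, 1 / (1 + (m : ℝ) ^ 2) := by
    rw [Fin.sum_univ_eq_sum_range fun m => 1 / (1 + (m : ℝ) ^ 2)]
    exact hs.sum_le_tsum _ fun m _ => h0 m
  have hrev : ∑ m : Fin n, 1 / (1 + (((m.rev : Fin n) : ℕ) : ℝ) ^ 2) =
      ∑ m : Fin n, 1 / (1 + ((m : ℕ) : ℝ) ^ 2) :=
    Equiv.sum_comp Fin.revPerm fun m : Fin n => 1 / (1 + ((m : ℕ) : ℝ) ^ 2)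
  calc ∑ m : Fin n, 1 / (1 + foldFreq n m ^ 2) ≤ _ := Finset.sum_le_sum fun m _ => hle m
    _ ≤ _ := by rw [Finset.sum_add_distrib, hrev]; linarith

/-! ### The fluctuation statistic and the deterministic error bounds -/

/-- Minus the logarithm of the aliased spectrum at `α = 1`. -/
noncomputable def logDecay (n m : ℕ) (s : ℝ) : ℝ := -Real.log (aliasSum s 1 n m)

/-- The order of magnitude of the logarithm of the spectrum. -/
noncomputable def logScale (n : ℕ) : ℝ := 1 + Real.log (1 + (n : ℝ) ^ 2)

/-- The sum of all the empirical fluctuations of `U` that enter the analysis of the profile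
likelihood: of its mean, of its increments along the `n`-point grid of `[σ, S]` paired with
`logDecay`, of its low-frequency part, and of its means over two blocks of frequencies. -/
noncomputable def fluctuation (σ S : ℝ) (k n : ℕ) (U : Fin n → ℝ) : ℝ :=
  |avg fun m => U m - 1| +
  ∑ i ∈ Finset.range n, |avg fun m : Fin n =>
    (logDecay n m (σ + (i + 1 : ℕ) * ((S - σ) / n)) - logDecay n m (σ + (i : ℕ) * ((S - σ) / n))) *
      (U m - 1)| +
  avg (fun m => 1 / (1 + foldFreq n m ^ 2) * U m) +
  |(n : ℝ)⁻¹ * ∑ m ∈ freqBlock k n, (U m - 1)| +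
  |(n : ℝ)⁻¹ * ∑ m ∈ freqBlock 2 n, (U m - 1)|

lemma one_le_logScale (n : ℕ) : 1 ≤ logScale n := by
  have : 0 ≤ Real.log (1 + (n : ℝ) ^ 2) := Real.log_nonneg (by nlinarith [sq_nonneg (n : ℝ)])
  unfold logScale; linarith

lemma logDecay_eq (n m : ℕ) (s : ℝ) :
    logDecay n m s = s * Real.log (1 + foldFreq n m ^ 2) - logAliasRemainder n m s := by
  rw [logDecay, logAliasRemainder]; ring

lemma abs_logDecay_sub_le {σ C : ℝ} (hC0 : 0 ≤ C)
    (hC : ∀ n m : ℕ, 1 ≤ n → m ≤ n → ∀ s t : ℝ, σ ≤ s → σ ≤ t →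
      |logAliasRemainder n m s - logAliasRemainder n m t| ≤ C * |s - t|)
    {n m : ℕ} (hn : 1 ≤ n) (hm : m ≤ n) {s t : ℝ} (hs : σ ≤ s) (ht : σ ≤ t) :
    |logDecay n m s - logDecay n m t| ≤ (1 + C) * logScale n * |s - t| := by
  have h0 : 0 ≤ Real.log (1 + foldFreq n m ^ 2) :=
    Real.log_nonneg (by nlinarith [sq_nonneg (foldFreq n m)])
  have h1 : Real.log (1 + foldFreq n m ^ 2) ≤ Real.log (1 + (n : ℝ) ^ 2) := by
    have := foldFreq_nonneg hm
    have := foldFreq_le hm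
    gcongr
  have h2 : logDecay n m s - logDecay n m t = (s - t) * Real.log (1 + foldFreq n m ^ 2) -
      (logAliasRemainder n m s - logAliasRemainder n m t) := by
    rw [logDecay_eq, logDecay_eq]; ring
  have h3 : |(s - t) * Real.log (1 + foldFreq n m ^ 2)| ≤ logScale n * |s - t| := by
    rw [abs_mul, abs_of_nonneg h0, mul_comm]
    gcongr
    unfold logScale; linarith
  have h4 : C * |s - t| ≤ C * logScale n * |s - t| := by
    have := one_le_logScale n
    gcongr
    nlinarith
  rw [h2]
  refine (abs_sub _ _).trans ?_
  linarith [hC n m hn hm s t hs ht]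

lemma abs_logRatio_sub_le {σ S a b : ℝ} (hσ : 1 / 2 < σ) (ha : 0 < a) (ha1 : a ≤ 1) (hb1 : 1 ≤ b)
    {θ₀ θ : MaternParam} (hν₀ : θ₀.nu + 1 / 2 ∈ Icc σ S) (hν : θ.nu + 1 / 2 ∈ Icc σ S)
    (hα₀ : θ₀.alpha ∈ Icc a b) (hα : θ.alpha ∈ Icc a b) {n : ℕ} (hn : 1 ≤ n) (m : Fin n) :
    |logRatio θ₀ θ n m - (logDecay n m (θ.nu + 1 / 2) - logDecay n m (θ₀.nu + 1 / 2))| ≤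
      2 * (S * b ^ 2 * (1 + (a ^ 2)⁻¹)) * (1 / (1 + foldFreq n m ^ 2)) := by
  have h1 := abs_log_aliasSum_sub_le (hσ.trans_le hν₀.1) hν₀.2 ha hα₀.1 ha1 hα₀.2 hb1 hn m.2.le
  have h2 := abs_log_aliasSum_sub_le (hσ.trans_le hν.1) hν.2 ha hα.1 ha1 hα.2 hb1 hn m.2.le
  have h3 : logRatio θ₀ θ n m - (logDecay n m (θ.nu + 1 / 2) - logDecay n m (θ₀.nu + 1 / 2)) =
      (Real.log (aliasSum (θ₀.nu + 1 / 2) θ₀.alpha n m) -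
        Real.log (aliasSum (θ₀.nu + 1 / 2) 1 n m)) -
      (Real.log (aliasSum (θ.nu + 1 / 2) θ.alpha n m) -
        Real.log (aliasSum (θ.nu + 1 / 2) 1 n m)) := by
    rw [logRatio, logDecay, logDecay]; ring
  rw [h3, mul_one_div, mul_div_assoc]
  refine (abs_sub _ _).trans ?_
  linarith

/-- The remainders in `logDecay` move by at most `C |s - t|` on each block, whereas the leading
terms move apart by at least `(2C + 2) |s - t|`. -/
lemma two_mul_le_logDecay_separation {σ C : ℝ}
    (hC : ∀ n m : ℕ, 1 ≤ n → m ≤ n → ∀ s t : ℝ, σ ≤ s → σ ≤ t →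
      |logAliasRemainder n m s - logAliasRemainder n m t| ≤ C * |s - t|)
    {k n : ℕ} (hk : 2 ≤ k) (hkC : Real.exp (2 * C + 2) ≤ k ^ 2 / 32) {i j : Fin n}
    (hi : i ∈ freqBlock k n) (hj : j ∈ freqBlock 2 n) {s t : ℝ} (hs : σ ≤ s) (ht : σ ≤ t) :
    2 * |s - t| ≤ |(logDecay n i s - logDecay n i t) - (logDecay n j s - logDecay n j t)| := by
  have hn : 1 ≤ n := i.pos
  have h1 := log_freq_separation hk hkC hi hj
  have h2 := hC n i hn i.2.le s t hs ht
  have h3 := hC n j hn j.2.le s t hs ht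
  have h4 : (s - t) * (Real.log (1 + foldFreq n j ^ 2) - Real.log (1 + foldFreq n i ^ 2)) =
      (-((logDecay n i s - logDecay n i t) - (logDecay n j s - logDecay n j t)) -
      (logAliasRemainder n i s - logAliasRemainder n i t)) +
      (logAliasRemainder n j s - logAliasRemainder n j t) := by
    simp only [logDecay_eq]; ring
  have h5 := abs_add_le (-((logDecay n i s - logDecay n i t) - (logDecay n j s - logDecay n j t)) -
      (logAliasRemainder n i s - logAliasRemainder n i t))
      (logAliasRemainder n j s - logAliasRemainder n j t)
  have h6 := abs_sub (-((logDecay n i s - logDecay n i t) - (logDecay n j s - logDecay n j t)))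
      (logAliasRemainder n i s - logAliasRemainder n i t)
  rw [abs_neg] at h6
  rw [← h4, abs_mul] at h5
  have h7 : |s - t| * (2 * C + 2) ≤ |s - t| *
      |Real.log (1 + foldFreq n j ^ 2) - Real.log (1 + foldFreq n i ^ 2)| := by
    gcongr
    exact h1.trans (le_abs_self _)
  linarith

lemma le_freqBlock_avg {k l n : ℕ} (hl : 2 ≤ l) (hlk : l ≤ k) (hn : 4 * k ≤ n) {U : Fin n → ℝ}
    (hT : |(n : ℝ)⁻¹ * ∑ m ∈ freqBlock l n, (U m - 1)| ≤ 1 / (8 * k)) :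
    1 / (8 * k : ℝ) ≤ (n : ℝ)⁻¹ * ∑ m ∈ freqBlock l n, U m := by
  have h1 := le_card_freqBlock hl (by omega : 4 * l ≤ n)
  have hl0 : (0 : ℝ) < l := by exact_mod_cast (by omega : 0 < l)
  have hlk' : (l : ℝ) ≤ k := by exact_mod_cast hlk
  have hk0 : (0 : ℝ) < k := hl0.trans_le hlk'
  have h2 : 1 / (4 * k : ℝ) ≤ 1 / (4 * l) := by gcongr
  have h3 : 1 / (4 * k : ℝ) = 1 / (8 * k) + 1 / (8 * k) := by field_simp; norm_num
  rw [Finset.sum_sub_distrib, Finset.sum_const, nsmul_eq_mul, mul_one, mul_sub] at hT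
  linarith [(abs_le.1 hT).1]

/-- The noise term is controlled, uniformly in the two regularities, by its increments over the
grid. -/
lemma abs_avg_mul_logDecay_sub_le {σ S C : ℝ} (hC0 : 0 ≤ C)
    (hC : ∀ n m : ℕ, 1 ≤ n → m ≤ n → ∀ s t : ℝ, σ ≤ s → σ ≤ t →
      |logAliasRemainder n m s - logAliasRemainder n m t| ≤ C * |s - t|)
    {n : ℕ} (hn : 1 ≤ n) {U : Fin n → ℝ} (hU : ∀ m, 0 ≤ U m) (hmean : avg U ≤ 2)
    {s t : ℝ} (hs : s ∈ Icc σ S) (ht : t ∈ Icc σ S) :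
    |avg fun m : Fin n => (U m - 1) * (logDecay n m s - logDecay n m t)| ≤
      2 * ∑ i ∈ Finset.range n, |avg fun m : Fin n =>
        (logDecay n m (σ + (i + 1 : ℕ) * ((S - σ) / n)) -
          logDecay n m (σ + (i : ℕ) * ((S - σ) / n))) * (U m - 1)| +
      6 * (1 + C) * (S - σ) * logScale n / n := by
  set F : ℝ → ℝ := fun s => avg fun m : Fin n => logDecay n m s * (U m - 1) with hF
  have hFsub : ∀ s t, F s - F t =
      avg fun m : Fin n => (logDecay n m s - logDecay n m t) * (U m - 1) := fun s t => by
    simp only [hF]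
    rw [← avg_sub]
    congr 1; ext m; ring
  have hΛ := one_le_logScale n
  set M := (1 + C) * logScale n * 3 with hM
  have hM0 : 0 ≤ M := by positivity
  have hlip : ∀ s t, σ ≤ s → σ ≤ t → |F s - F t| ≤ M * |s - t| := by
    intro s t hs ht
    rw [hFsub]
    refine abs_avg_le.trans ?_
    have h1 : avg (fun m : Fin n => |(logDecay n m s - logDecay n m t) * (U m - 1)|) ≤
        avg fun m => ((1 + C) * logScale n * |s - t|) * (U m + 1) := by
      refine avg_mono fun m => ?_
      rw [abs_mul]
      have h2 : |U m - 1| ≤ U m + 1 := by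
        rw [abs_le]; constructor <;> linarith [hU m]
      have := abs_logDecay_sub_le hC0 hC hn m.2.le hs ht
      gcongr
    refine h1.trans ?_
    rw [avg_const_mul, avg_add, avg_const hn, hM]
    have h3 : 0 ≤ (1 + C) * logScale n * |s - t| := by positivity
    nlinarith
  have key : ∀ s ∈ Icc σ S, |F s - F σ| ≤ ∑ i ∈ Finset.range n, |avg fun m : Fin n =>
        (logDecay n m (σ + (i + 1 : ℕ) * ((S - σ) / n)) -
          logDecay n m (σ + (i : ℕ) * ((S - σ) / n))) * (U m - 1)| + M * ((S - σ) / n) := by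
    intro s hs
    have := abs_sub_le_sum_increments hM0 hlip hn hs.1 hs.2
    simpa only [hFsub] using this
  have h1 : (avg fun m : Fin n => (U m - 1) * (logDecay n m s - logDecay n m t)) = F s - F t := by
    rw [hFsub]; congr 1; ext m; ring
  have h2 := abs_sub_le (F s) (F σ) (F t)
  rw [abs_sub_comm (F σ)] at h2
  have h3 := key s hs
  have h4 := key t ht
  have h5 : 6 * (1 + C) * (S - σ) * logScale n / n = 2 * (M * ((S - σ) / n)) := by
    rw [hM]; ring
  rw [h1, h5]
  linarith

lemma fluctuation_parts {σ S : ℝ} {k n : ℕ} {U : Fin n → ℝ} (hU : ∀ m, 0 ≤ U m) (hn : 1 ≤ n)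
    {T : ℝ} (hT : fluctuation σ S k n U ≤ T) :
    |avg U - 1| ≤ T ∧
    (∑ i ∈ Finset.range n, |avg fun m : Fin n =>
      (logDecay n m (σ + (i + 1 : ℕ) * ((S - σ) / n)) -
        logDecay n m (σ + (i : ℕ) * ((S - σ) / n))) * (U m - 1)|) ≤ T ∧
    avg (fun m => 1 / (1 + foldFreq n m ^ 2) * U m) ≤ T ∧
    |(n : ℝ)⁻¹ * ∑ m ∈ freqBlock k n, (U m - 1)| ≤ T ∧
    |(n : ℝ)⁻¹ * ∑ m ∈ freqBlock 2 n, (U m - 1)| ≤ T := by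
  have h1 := abs_nonneg (avg fun m => U m - 1)
  have h2 : 0 ≤ ∑ i ∈ Finset.range n, |avg fun m : Fin n =>
      (logDecay n m (σ + (i + 1 : ℕ) * ((S - σ) / n)) -
        logDecay n m (σ + (i : ℕ) * ((S - σ) / n))) * (U m - 1)| :=
    Finset.sum_nonneg fun _ _ => abs_nonneg _
  have h3 : 0 ≤ avg (fun m => 1 / (1 + foldFreq n m ^ 2) * U m) :=
    avg_nonneg fun m => mul_nonneg (by positivity) (hU m)
  have h4 := abs_nonneg ((n : ℝ)⁻¹ * ∑ m ∈ freqBlock k n, (U m - 1))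
  have h5 := abs_nonneg ((n : ℝ)⁻¹ * ∑ m ∈ freqBlock 2 n, (U m - 1))
  have h6 : (avg fun m => U m - 1) = avg U - 1 := by rw [avg_sub, avg_const hn]
  unfold fluctuation at hT
  rw [← h6]
  refine ⟨?_, ?_, ?_, ?_, ?_⟩ <;> linarith

/-- The low-frequency errors do not spoil the separation of two blocks, unless the regularities
differ by `O(1 / n)` only. -/
lemma abs_le_logRatio_separation {σ C κ : ℝ} (hκ0 : 0 ≤ κ)
    (hC : ∀ n m : ℕ, 1 ≤ n → m ≤ n → ∀ s t : ℝ, σ ≤ s → σ ≤ t →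
      |logAliasRemainder n m s - logAliasRemainder n m t| ≤ C * |s - t|)
    {k n : ℕ} (hk : 2 ≤ k) (hkC : Real.exp (2 * C + 2) ≤ k ^ 2 / 32) {s t : ℝ} (hs : σ ≤ s)
    (ht : σ ≤ t) {r : Fin n → ℝ}
    (hr : ∀ m : Fin n, |r m - (logDecay n m s - logDecay n m t)| ≤
      κ * (1 / (1 + foldFreq n m ^ 2)))
    (hlarge : 8 * κ * k ^ 2 / n ≤ |s - t|) {i j : Fin n}
    (hi : i ∈ freqBlock k n) (hj : j ∈ freqBlock 2 n) : |s - t| ≤ |r i - r j| := by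
  have hn1 : (1 : ℝ) ≤ n := by
    have := i.pos
    exact_mod_cast this
  have h1 := two_mul_le_logDecay_separation hC hk hkC hi hj hs ht
  have hbound : ∀ (l : ℕ) (m : Fin n), 2 ≤ l → (l : ℝ) ≤ k → m ∈ freqBlock l n →
      κ * (1 / (1 + foldFreq n m ^ 2)) ≤ 4 * κ * k ^ 2 / n := by
    intro l m hl hlk hm
    have h5 := inv_one_add_foldFreq_sq_le hl hm
    have h6 : 4 * (l : ℝ) ^ 2 / (n : ℝ) ^ 2 ≤ 4 * k ^ 2 / n := by
      have : (n : ℝ) ≤ (n : ℝ) ^ 2 := by nlinarith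
      gcongr
    calc κ * (1 / (1 + foldFreq n m ^ 2)) ≤ κ * (4 * k ^ 2 / n) :=
          mul_le_mul_of_nonneg_left (h5.trans h6) hκ0
      _ = _ := by ring
  have h2 := (hr i).trans (hbound k i hk le_rfl hi)
  have h3 := (hr j).trans (hbound 2 j le_rfl (by exact_mod_cast hk) hj)
  have h8 : 4 * κ * k ^ 2 / n + 4 * κ * k ^ 2 / n = 8 * κ * k ^ 2 / n := by ring
  set di := logDecay n i s - logDecay n i t
  set dj := logDecay n j s - logDecay n j t
  have h10 := abs_sub (r i - r j) ((r i - di) - (r j - dj))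
  have h11 := abs_sub (r i - di) (r j - dj)
  rw [show (r i - r j) - ((r i - di) - (r j - dj)) = di - dj by ring] at h10
  linarith

/-- Every term of the bound on the squared separation is at most a constant times
`Λ (T + 1 / n)`. -/
lemma collect_error_terms {κ e Cg B C Λ T x G g N u : ℝ} (hκ : 0 ≤ κ) (he : 0 ≤ e)
    (hCg : 0 ≤ Cg) (hB : 0 ≤ B) (hC : 0 ≤ C) (hΛ : 1 ≤ Λ) (hT : 0 ≤ T) (hx : 0 ≤ x) (hG : G ≤ T)
    (hg : g ≤ Cg * x) (hN : N ≤ 2 * T + 6 * (1 + C) * B * Λ * x) (hu : u ≤ T) :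
    4 * κ * e * G + 2 * κ * g + 2 * N + 2 * ((1 + C) * B * Λ) * u ≤
      (4 * κ * e + 2 * κ * Cg + 4 + 12 * (1 + C) * B + 2 * (1 + C) * B) * (Λ * (T + x)) := by
  have hTΛ : T ≤ Λ * (T + x) := by nlinarith
  have hnΛ : x ≤ Λ * (T + x) := by nlinarith
  have hxΛ : Λ * x ≤ Λ * (T + x) := by gcongr; linarith
  have huΛ : Λ * u ≤ Λ * (T + x) := by gcongr; linarith
  have e1 : 4 * κ * e * G ≤ 4 * κ * e * (Λ * (T + x)) := by gcongr; exact hG.trans hTΛ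
  have e2 : 2 * κ * g ≤ 2 * κ * (Cg * (Λ * (T + x))) := by
    gcongr
    exact hg.trans (by gcongr)
  have e3 : 12 * (1 + C) * B * (Λ * x) ≤ 12 * (1 + C) * B * (Λ * (T + x)) := by gcongr
  have e4 : 2 * (1 + C) * B * (Λ * u) ≤ 2 * (1 + C) * B * (Λ * (T + x)) := by gcongr
  linarith

/-- The bound on the squared regularity error with explicit constants, for errors that are not
already of order `1 / n`. -/
lemma sq_nu_sub_le {σ S a b C Cg κ B : ℝ} (hσ : 1 / 2 < σ) (hσS : σ ≤ S) (ha : 0 < a)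
    (ha1 : a ≤ 1) (hb1 : 1 ≤ b) (hC0 : 0 ≤ C)
    (hC : ∀ n m : ℕ, 1 ≤ n → m ≤ n → ∀ s t : ℝ, σ ≤ s → σ ≤ t →
      |logAliasRemainder n m s - logAliasRemainder n m t| ≤ C * |s - t|) (hCg0 : 0 ≤ Cg)
    (hCg : ∀ n : ℕ, avg (fun m : Fin n => 1 / (1 + foldFreq n m ^ 2)) ≤ Cg / n)
    (hκ : κ = 2 * (S * b ^ 2 * (1 + (a ^ 2)⁻¹))) (hB : B = S - σ)
    {k n : ℕ} (hk : 2 ≤ k) (hkC : Real.exp (2 * C + 2) ≤ (k : ℝ) ^ 2 / 32) (hn : 4 * k ≤ n)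
    {U : Fin n → ℝ} (hU : ∀ m, 0 ≤ U m) {T : ℝ} (hT : fluctuation σ S k n U ≤ T)
    (hTk : T ≤ 1 / (8 * k)) {θ₀ θ θ₁ : MaternParam} (hν₀ : θ₀.nu + 1 / 2 ∈ Icc σ S)
    (hν : θ.nu + 1 / 2 ∈ Icc σ S) (hν₁ : θ₁.nu = θ₀.nu) (hα₀ : θ₀.alpha ∈ Icc a b)
    (hα : θ.alpha ∈ Icc a b) (hα₁ : θ₁.alpha ∈ Icc a b)
    (hprof : Real.log (avg fun m => Real.exp (logRatio θ₀ θ n m) * U m) - avg (logRatio θ₀ θ n) ≤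
      Real.log (avg fun m => Real.exp (logRatio θ₀ θ₁ n m) * U m) - avg (logRatio θ₀ θ₁ n))
    (hlarge : 8 * κ * k ^ 2 / n ≤ |θ.nu - θ₀.nu|) :
    (θ.nu - θ₀.nu) ^ 2 ≤ 384 * k * (1 + B) ^ 2 * (4 * κ * Real.exp κ + 2 * κ * Cg + 4 +
      12 * (1 + C) * B + 2 * (1 + C) * B) * (logScale n * (T + 1 / n)) := by
  have hκ0 : 0 ≤ κ := by
    have : 0 ≤ S := by linarith
    rw [hκ]
    positivity
  have hB0 : 0 ≤ B := by linarith
  have hn1 : 1 ≤ n := by omega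
  have hk0 : (0 : ℝ) < k := by exact_mod_cast (by omega : 0 < k)
  obtain ⟨hT1, hT2, hT3, hT4, hT5⟩ := fluctuation_parts hU hn1 hT
  have hT0 : 0 ≤ T := (abs_nonneg _).trans hT1
  have hΛ := one_le_logScale n
  have hδ : (θ.nu + 1 / 2) - (θ₀.nu + 1 / 2) = θ.nu - θ₀.nu := by ring
  have hδB : |θ.nu - θ₀.nu| ≤ B := by
    rw [← hδ, abs_le, hB]
    constructor <;> linarith [hν.1, hν.2, hν₀.1, hν₀.2]
  have hT12 : T ≤ 1 / 2 := by
    refine hTk.trans ?_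
    have : (2 : ℝ) ≤ k := by exact_mod_cast hk
    rw [div_le_div_iff₀ (by positivity) (by norm_num)]
    linarith
  have hr : ∀ m : Fin n, |logRatio θ₀ θ n m - (logDecay n m (θ.nu + 1 / 2) -
      logDecay n m (θ₀.nu + 1 / 2))| ≤ κ * (1 / (1 + foldFreq n m ^ 2)) := fun m =>
    hκ ▸ abs_logRatio_sub_le hσ ha ha1 hb1 hν₀ hν hα₀ hα hn1 m
  have hsep : ∀ i ∈ freqBlock k n, ∀ j ∈ freqBlock 2 n,
      |θ.nu - θ₀.nu| / (1 + B) ≤ |logRatio θ₀ θ n i - logRatio θ₀ θ n j| := by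
    intro i hi j hj
    have h1 := abs_le_logRatio_separation hκ0 hC hk hkC hν.1 hν₀.1 hr (by rwa [hδ]) hi hj
    rw [hδ] at h1
    exact (div_le_self (abs_nonneg _) (by linarith)).trans h1
  have hd : ∀ m : Fin n, |logDecay n m (θ.nu + 1 / 2) - logDecay n m (θ₀.nu + 1 / 2)| ≤
      (1 + C) * B * logScale n := by
    intro m
    have h1 := abs_logDecay_sub_le hC0 hC hn1 m.2.le hν.1 hν₀.1
    rw [hδ] at h1
    have h2 : (1 + C) * logScale n * |θ.nu - θ₀.nu| ≤ (1 + C) * logScale n * B :=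
      mul_le_mul_of_nonneg_left hδB (by positivity)
    linarith
  have hr₁ : ∀ m : Fin n, |logRatio θ₀ θ₁ n m| ≤ κ * (1 / (1 + foldFreq n m ^ 2)) := by
    intro m
    have := abs_logRatio_sub_le hσ ha ha1 hb1 hν₀ (hν₁ ▸ hν₀) hα₀ hα₁ hn1 m
    rwa [hν₁, sub_self, sub_zero, ← hκ] at this
  have hg1 : ∀ m : Fin n, 1 / (1 + foldFreq n m ^ 2) ≤ 1 := fun m =>
    div_le_one_of_le₀ (by linarith [sq_nonneg (foldFreq n m)])
      (by linarith [sq_nonneg (foldFreq n m)])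
  have hmain := sq_separation_le hn1 hU (hT1.trans hT12)
    (fun m => (by positivity : 0 ≤ 1 / (1 + foldFreq n m ^ 2))) hg1 hκ0 hr hr₁ hd
    (by positivity) (le_freqBlock_avg hk le_rfl hn (hT4.trans hTk))
    (le_freqBlock_avg le_rfl hk hn (hT5.trans hTk)) (by positivity)
    (div_le_one_of_le₀ (by linarith) (by linarith)) hsep hprof
  have hu2 : avg U ≤ 2 := by linarith [(abs_le.1 (hT1.trans hT12)).2]
  have hN := abs_avg_mul_logDecay_sub_le (S := S) hC0 hC hn1 hU hu2 hν hν₀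
  rw [← hB] at hN
  have hlhs : 1 / (8 * k : ℝ) * (|θ.nu - θ₀.nu| / (1 + B)) ^ 2 / 48 =
      (θ.nu - θ₀.nu) ^ 2 / (384 * k * (1 + B) ^ 2) := by
    rw [div_pow, sq_abs]; field_simp; ring
  rw [hlhs, div_le_iff₀ (by positivity)] at hmain
  rw [← hB] at hT2
  have herr := collect_error_terms (Λ := logScale n) hκ0 (Real.exp_pos κ).le hCg0 hB0 hC0 hΛ hT0
    (x := 1 / n) (by positivity) hT3 ((hCg n).trans_eq (by ring))
    (hN.trans (add_le_add (mul_le_mul_of_nonneg_left hT2 zero_le_two) (by rw [mul_one_div]))) hT1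
  refine (hmain.trans (mul_le_mul_of_nonneg_right herr (by positivity))).trans_eq ?_
  ring

/-- A minimiser of the profile likelihood has a regularity whose squared error is controlled by the
fluctuations, up to a logarithm. -/
lemma exists_sq_nu_sub_le {σ S a b : ℝ} (hσ : 1 / 2 < σ) (hσS : σ ≤ S) (ha : 0 < a) (ha1 : a ≤ 1)
    (hb1 : 1 ≤ b) :
    ∃ k : ℕ, 2 ≤ k ∧ ∃ C : ℝ, 0 ≤ C ∧ ∀ n : ℕ, 4 * k ≤ n → ∀ U : Fin n → ℝ, (∀ m, 0 ≤ U m) →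
      ∀ T : ℝ, fluctuation σ S k n U ≤ T → T ≤ 1 / (8 * k) →
      ∀ θ₀ θ θ₁ : MaternParam, θ₀.nu + 1 / 2 ∈ Icc σ S → θ.nu + 1 / 2 ∈ Icc σ S →
        θ₁.nu = θ₀.nu → θ₀.alpha ∈ Icc a b → θ.alpha ∈ Icc a b → θ₁.alpha ∈ Icc a b →
        Real.log (avg fun m => Real.exp (logRatio θ₀ θ n m) * U m) - avg (logRatio θ₀ θ n) ≤
          Real.log (avg fun m => Real.exp (logRatio θ₀ θ₁ n m) * U m) - avg (logRatio θ₀ θ₁ n) →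
        (θ.nu - θ₀.nu) ^ 2 ≤ C * logScale n * (T + 1 / n) := by
  obtain ⟨C, hC0, hC⟩ := exists_lipschitz_logAliasRemainder hσ
  obtain ⟨Cg, hCg0, hCg⟩ := exists_avg_inv_one_add_foldFreq_sq_le
  obtain ⟨k, hk2, hkC⟩ : ∃ k : ℕ, 2 ≤ k ∧ Real.exp (2 * C + 2) ≤ (k : ℝ) ^ 2 / 32 := by
    obtain ⟨k₀, hk₀⟩ := exists_nat_ge (32 * Real.exp (2 * C + 2))
    refine ⟨k₀ + 2, by omega, ?_⟩
    rw [le_div_iff₀ (by norm_num)]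
    push_cast
    have : (0 : ℝ) ≤ k₀ := by positivity
    nlinarith
  obtain ⟨κ, hκ⟩ : ∃ κ, κ = 2 * (S * b ^ 2 * (1 + (a ^ 2)⁻¹)) := ⟨_, rfl⟩
  obtain ⟨B, hB⟩ : ∃ B, B = S - σ := ⟨_, rfl⟩
  have hκ0 : 0 ≤ κ := by
    have : 0 ≤ S := by linarith
    rw [hκ]
    positivity
  have hB0 : 0 ≤ B := by linarith
  obtain ⟨K₁, hK₁⟩ : ∃ K₁, K₁ = 384 * k * (1 + B) ^ 2 * (4 * κ * Real.exp κ + 2 * κ * Cg + 4 +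
    12 * (1 + C) * B + 2 * (1 + C) * B) := ⟨_, rfl⟩
  obtain ⟨K₂, hK₂⟩ : ∃ K₂, K₂ = 8 * κ * k ^ 2 * B := ⟨_, rfl⟩
  have hK₁0 : 0 ≤ K₁ := by rw [hK₁]; positivity
  have hK₂0 : 0 ≤ K₂ := by rw [hK₂]; positivity
  refine ⟨k, hk2, K₁ + K₂, by positivity, ?_⟩
  intro n hn U hU T hT hTk θ₀ θ θ₁ hν₀ hν hν₁ hα₀ hα hα₁ hprof
  have hT0 : 0 ≤ T := (abs_nonneg _).trans (fluctuation_parts hU (by omega) hT).1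
  have hΛ := one_le_logScale n
  have hx : (0 : ℝ) ≤ 1 / n := by positivity
  have hΛT : 0 ≤ logScale n * (T + 1 / n) := by positivity
  have h1 : 0 ≤ K₁ * (logScale n * (T + 1 / n)) := by positivity
  rcases lt_or_ge |θ.nu - θ₀.nu| (8 * κ * k ^ 2 / n) with hsmall | hlarge
  · -- Deviations of order `1 / n` are within the bound.
    have hδB : |θ.nu - θ₀.nu| ≤ B := by
      rw [abs_le, hB]
      constructor <;> linarith [hν.1, hν.2, hν₀.1, hν₀.2]
    have h2 : (θ.nu - θ₀.nu) ^ 2 ≤ K₂ * (1 / n) := by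
      rw [← sq_abs, sq]
      refine (mul_le_mul hsmall.le hδB (abs_nonneg _) (by positivity)).trans_eq ?_
      rw [hK₂]; ring
    have h3 : K₂ * (1 / n) ≤ K₂ * (logScale n * (T + 1 / n)) := by
      refine mul_le_mul_of_nonneg_left ?_ hK₂0
      nlinarith
    linarith
  · have h2 := sq_nu_sub_le hσ hσS ha ha1 hb1 hC0 hC hCg0 hCg hκ hB hk2 hkC hn hU hT hTk hν₀ hν hν₁
      hα₀ hα hα₁ hprof hlarge
    rw [← hK₁] at h2
    have h3 : 0 ≤ K₂ * (logScale n * (T + 1 / n)) := by positivity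
    linarith

/-- Once the regularity is known up to `o(1 / log n)`, the amplitude ratio is close to one. -/
lemma exists_abs_avg_exp_logRatio_sub_one_le {σ S a b : ℝ} (hσ : 1 / 2 < σ) (hσS : σ ≤ S)
    (ha : 0 < a) (ha1 : a ≤ 1) (hb1 : 1 ≤ b) :
    ∃ C : ℝ, 0 < C ∧ ∀ k n : ℕ, 1 ≤ n → ∀ U : Fin n → ℝ, (∀ m, 0 ≤ U m) →
      ∀ T : ℝ, fluctuation σ S k n U ≤ T → T ≤ 1 →
      ∀ θ₀ θ : MaternParam, θ₀.nu + 1 / 2 ∈ Icc σ S → θ.nu + 1 / 2 ∈ Icc σ S →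
        θ₀.alpha ∈ Icc a b → θ.alpha ∈ Icc a b → C * logScale n * |θ.nu - θ₀.nu| ≤ 1 →
        |avg (fun m => Real.exp (logRatio θ₀ θ n m) * U m) - 1| ≤
          C * (logScale n * |θ.nu - θ₀.nu| + T) := by
  obtain ⟨C, hC0, hC⟩ := exists_lipschitz_logAliasRemainder hσ
  set κ := 2 * (S * b ^ 2 * (1 + (a ^ 2)⁻¹)) with hκ
  have hκ0 : 0 ≤ κ := by
    have : 0 ≤ S := by linarith
    positivity
  set E := Real.exp (1 + κ) with hE
  refine ⟨(1 + C) * (1 + 2 * E) + κ * E + 1, by positivity, ?_⟩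
  intro k n hn U hU T hT hT1 θ₀ θ hν₀ hν hα₀ hα hsmall
  obtain ⟨hT1', -, hT3, -, -⟩ := fluctuation_parts hU hn hT
  have hT0 : 0 ≤ T := (abs_nonneg _).trans hT1'
  have hΛ := one_le_logScale n
  set Λ := logScale n with hΛdef
  have hδ : (θ.nu + 1 / 2) - (θ₀.nu + 1 / 2) = θ.nu - θ₀.nu := by ring
  set δ := θ.nu - θ₀.nu with hδdef
  set y := (1 + C) * Λ * |δ| with hy
  have hy0 : 0 ≤ y := by positivity
  have hy1 : y ≤ 1 := by
    have h1 : 0 ≤ (1 + C) * (2 * E) := by positivity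
    have h2 : 0 ≤ κ * E := by positivity
    have h3 : (1 + C) * (Λ * |δ|) ≤ ((1 + C) * (1 + 2 * E) + κ * E + 1) * (Λ * |δ|) :=
      mul_le_mul_of_nonneg_right (by linarith) (by positivity)
    rw [hy]
    linarith
  have hr : ∀ m : Fin n, |Real.exp (logRatio θ₀ θ n m) - 1| ≤
      (y + κ * (1 / (1 + foldFreq n m ^ 2))) * E := by
    intro m
    have h1 := abs_logRatio_sub_le hσ ha ha1 hb1 hν₀ hν hα₀ hα hn m
    have h2 := abs_logDecay_sub_le hC0 hC hn m.2.le hν.1 hν₀.1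
    rw [hδ] at h2
    rw [← hκ] at h1
    have h3 : 1 / (1 + foldFreq n m ^ 2) ≤ 1 :=
      div_le_one_of_le₀ (by nlinarith [sq_nonneg (foldFreq n m)]) (by positivity)
    refine exp_sub_one_le ?_ (by nlinarith)
    have h4 := abs_sub_abs_le_abs_sub (logRatio θ₀ θ n m)
      (logDecay n m (θ.nu + 1 / 2) - logDecay n m (θ₀.nu + 1 / 2))
    linarith
  have h1 : |avg fun m => (Real.exp (logRatio θ₀ θ n m) - 1) * U m| ≤
      E * y * avg U + E * κ * avg (fun m => 1 / (1 + foldFreq n m ^ 2) * U m) := by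
    refine abs_avg_le.trans ?_
    rw [← avg_const_mul, ← avg_const_mul, ← avg_add]
    refine avg_mono fun m => ?_
    rw [abs_mul, abs_of_nonneg (hU m)]
    have := mul_le_mul_of_nonneg_right (hr m) (hU m)
    linarith
  have h2 : avg (fun m => Real.exp (logRatio θ₀ θ n m) * U m) - 1 =
      (avg fun m => (Real.exp (logRatio θ₀ θ n m) - 1) * U m) + (avg U - 1) := by
    have : (avg fun m => (Real.exp (logRatio θ₀ θ n m) - 1) * U m) =
        avg (fun m => Real.exp (logRatio θ₀ θ n m) * U m) - avg U := by
      rw [← avg_sub]; congr 1; ext m; ring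
    rw [this]; ring
  have hu2 : avg U ≤ 2 := by linarith [(abs_le.1 hT1').2]
  have h3 : E * y * avg U ≤ E * y * 2 := by gcongr
  have h4 : E * κ * avg (fun m => 1 / (1 + foldFreq n m ^ 2) * U m) ≤ E * κ * T := by gcongr
  rw [h2]
  have h5 := abs_add_le (avg fun m => (Real.exp (logRatio θ₀ θ n m) - 1) * U m) (avg U - 1)
  have h6 : 0 ≤ (1 + C + κ * E + 1) * (Λ * |δ|) := by positivity
  have h7 : 0 ≤ (1 + C) * (1 + 2 * E) * T := by positivity
  rw [hy] at h3
  linarith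

/-! ### The fluctuations are small in probability -/

section Fluctuation

variable {Ω : Type*} [MeasurableSpace Ω] {P : Measure Ω} [IsProbabilityMeasure P]

lemma integral_abs_avg_centred_le {n : ℕ} {U : Fin n → Ω → ℝ} {V : ℝ}
    (hL2 : ∀ m, MemLp (U m) 2 P) (hmean : ∀ m, ∫ ω, U m ω ∂P = 1)
    (hvar : ∀ m, variance (U m) P = V) (hind : iIndepFun U P) {c : Fin n → ℝ} {A : ℝ} (hA : 0 ≤ A)
    (hc : ∀ m, |c m| ≤ A) :
    Integrable (fun ω => |avg fun m => c m * (U m ω - 1)|) P ∧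
    ∫ ω, |avg fun m => c m * (U m ω - 1)| ∂P ≤ A * √V / √n := by
  have he : ∀ ω, (avg fun m => c m * (U m ω - 1)) = ∑ m, ((n : ℝ)⁻¹ * c m) * (U m ω - 1) := by
    intro ω
    rw [avg, Finset.mul_sum]
    exact Finset.sum_congr rfl fun m _ => by ring
  simp only [he]
  constructor
  · refine Integrable.abs (integrable_finsetSum _ fun m _ => ?_)
    exact (((hL2 m).integrable one_le_two).sub (integrable_const 1)).const_mul _
  · rcases Nat.eq_zero_or_pos n with rfl | hn
    · simp
    have hn0 : (0 : ℝ) < n := by exact_mod_cast hn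
    have hV : 0 ≤ V := hvar ⟨0, hn⟩ ▸ variance_nonneg _ _
    refine (integral_abs_sum_centred_le hL2 hmean hvar hind _).trans ?_
    have h1 : ∑ m : Fin n, ((n : ℝ)⁻¹ * c m) ^ 2 ≤ A ^ 2 / n := by
      calc ∑ m : Fin n, ((n : ℝ)⁻¹ * c m) ^ 2 ≤ ∑ _m : Fin n, ((n : ℝ)⁻¹ * A) ^ 2 := by
            refine Finset.sum_le_sum fun m _ => ?_
            rw [mul_pow, mul_pow, ← sq_abs (c m)]
            have := hc m
            gcongr
        _ = A ^ 2 / n := by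
            rw [Finset.sum_const, Finset.card_univ, Fintype.card_fin, nsmul_eq_mul]
            field_simp
    refine (Real.sqrt_le_sqrt (mul_le_mul_of_nonneg_left h1 hV)).trans_eq ?_
    rw [Real.sqrt_mul hV, Real.sqrt_div (sq_nonneg A), Real.sqrt_sq hA]
    ring

lemma integral_abs_block_centred_le {n : ℕ} {U : Fin n → Ω → ℝ} {V : ℝ}
    (hL2 : ∀ m, MemLp (U m) 2 P) (hmean : ∀ m, ∫ ω, U m ω ∂P = 1)
    (hvar : ∀ m, variance (U m) P = V) (hind : iIndepFun U P) (B : Finset (Fin n)) :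
    Integrable (fun ω => |(n : ℝ)⁻¹ * ∑ m ∈ B, (U m ω - 1)|) P ∧
    ∫ ω, |(n : ℝ)⁻¹ * ∑ m ∈ B, (U m ω - 1)| ∂P ≤ √V / √n := by
  have h := integral_abs_avg_centred_le hL2 hmean hvar hind
    (c := fun m => if m ∈ B then 1 else 0) zero_le_one (fun m => by split_ifs <;> simp)
  simpa [avg] using h

lemma integral_low_freq_le {n : ℕ} {U : Fin n → Ω → ℝ} (hL2 : ∀ m, MemLp (U m) 2 P)
    (hmean : ∀ m, ∫ ω, U m ω ∂P = 1) (c : Fin n → ℝ) :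
    Integrable (fun ω => avg fun m => c m * U m ω) P ∧
    ∫ ω, (avg fun m => c m * U m ω) ∂P = avg c := by
  have hi : ∀ m, Integrable (fun ω => c m * U m ω) P := fun m =>
    ((hL2 m).integrable one_le_two).const_mul _
  refine ⟨(integrable_finsetSum _ fun m _ => hi m).const_mul _, ?_⟩
  simp only [avg]
  rw [integral_const_mul, integral_finsetSum _ fun m _ => hi m]
  simp only [integral_const_mul, hmean, mul_one]

/-- The expected fluctuation of independent variables with common variance is of order
`log n / √n`. The grid of `logDecay` costs nothing, because its `n` increments are each of order
`log n / n`. -/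
lemma exists_integral_fluctuation_le {σ S : ℝ} (hσ : 1 / 2 < σ) (hσS : σ ≤ S) (V : ℝ) :
    ∃ K : ℝ, 0 ≤ K ∧ ∀ k n : ℕ, 1 ≤ n → ∀ U : Fin n → Ω → ℝ, (∀ m, MemLp (U m) 2 P) →
      (∀ m, ∫ ω, U m ω ∂P = 1) → (∀ m, variance (U m) P = V) → iIndepFun U P →
      Integrable (fun ω => fluctuation σ S k n fun m => U m ω) P ∧
      ∫ ω, fluctuation σ S k n (fun m => U m ω) ∂P ≤ K * logScale n / √n := by
  obtain ⟨C, hC0, hC⟩ := exists_lipschitz_logAliasRemainder hσ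
  obtain ⟨Cg, hCg0, hCg⟩ := exists_avg_inv_one_add_foldFreq_sq_le
  have hB : 0 ≤ S - σ := by linarith
  refine ⟨3 * √V + (1 + C) * (S - σ) * √V + Cg, by positivity, ?_⟩
  intro k n hn U hL2 hmean hvar hind
  have hn1 : (1 : ℝ) ≤ n := by exact_mod_cast hn
  have hn0 : (0 : ℝ) < n := by linarith
  have hΛ := one_le_logScale n
  obtain ⟨i1, b1⟩ := integral_abs_avg_centred_le hL2 hmean hvar hind (c := fun _ => 1) zero_le_one
    (fun m => by simp)
  have hinc : ∀ i : ℕ, ∀ m : Fin n, |logDecay n m (σ + (i + 1 : ℕ) * ((S - σ) / n)) -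
      logDecay n m (σ + (i : ℕ) * ((S - σ) / n))| ≤
      (1 + C) * logScale n * ((S - σ) / n) := by
    intro i m
    have hh : 0 ≤ (S - σ) / n := by positivity
    have h1 : 0 ≤ ((i + 1 : ℕ) : ℝ) * ((S - σ) / n) := by positivity
    have h2 : 0 ≤ (i : ℝ) * ((S - σ) / n) := by positivity
    have := abs_logDecay_sub_le hC0 hC hn m.2.le
      (s := σ + (i + 1 : ℕ) * ((S - σ) / n)) (t := σ + (i : ℕ) * ((S - σ) / n))
      (by linarith) (by linarith)
    rwa [show σ + ((i + 1 : ℕ) : ℝ) * ((S - σ) / n) - (σ + (i : ℕ) * ((S - σ) / n)) =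
      (S - σ) / n by push_cast; ring, abs_of_nonneg hh] at this
  have h2 := fun i : ℕ => integral_abs_avg_centred_le hL2 hmean hvar hind
    (by positivity) (hinc i)
  obtain ⟨i3, b3⟩ := integral_low_freq_le hL2 hmean fun m : Fin n => 1 / (1 + foldFreq n m ^ 2)
  obtain ⟨i4, b4⟩ := integral_abs_block_centred_le hL2 hmean hvar hind (freqBlock k n)
  obtain ⟨i5, b5⟩ := integral_abs_block_centred_le hL2 hmean hvar hind (freqBlock 2 n)
  have i2 := integrable_finsetSum (Finset.range n) fun i _ => (h2 i).1
  have b2 : ∫ ω, ∑ i ∈ Finset.range n, |avg fun m : Fin n =>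
      (logDecay n m (σ + (i + 1 : ℕ) * ((S - σ) / n)) -
        logDecay n m (σ + (i : ℕ) * ((S - σ) / n))) * (U m ω - 1)| ∂P ≤
      (1 + C) * (S - σ) * √V * logScale n / √n := by
    rw [integral_finsetSum _ fun i _ => (h2 i).1]
    refine (Finset.sum_le_sum fun i _ => (h2 i).2).trans_eq ?_
    rw [Finset.sum_const, Finset.card_range, nsmul_eq_mul]
    field_simp
  simp only [one_mul] at i1 b1
  refine ⟨(((i1.add i2).add i3).add i4).add i5, ?_⟩
  have e2 := integral_add' i1 i2
  have e3 := integral_add' (i1.add i2) i3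
  have e4 := integral_add' ((i1.add i2).add i3) i4
  have e5 := integral_add' (((i1.add i2).add i3).add i4) i5
  refine e5.trans_le ?_
  rw [e4, e3, e2, b3]
  have hs1 : √V / √n ≤ √V * logScale n / √n := by
    gcongr
    exact le_mul_of_one_le_right (Real.sqrt_nonneg _) hΛ
  have hs2 : Cg / n ≤ Cg * logScale n / √n := by
    have h5 : √(n : ℝ) ≤ n := by
      rw [Real.sqrt_le_left hn0.le]
      nlinarith
    have h6 : 0 < √(n : ℝ) := Real.sqrt_pos.2 hn0
    gcongr
    exact le_mul_of_one_le_right hCg0 hΛ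
  have hfin : (3 * √V + (1 + C) * (S - σ) * √V + Cg) * logScale n / √n =
      √V * logScale n / √n + (1 + C) * (S - σ) * √V * logScale n / √n + Cg * logScale n / √n +
      √V * logScale n / √n + √V * logScale n / √n := by ring
  rw [hfin]
  linarith [hCg n]

end Fluctuation

lemma logScale_le {n : ℕ} (hn : 2 ≤ n) : logScale n ≤ 5 * Real.log n := by
  have hn2 : (2 : ℝ) ≤ n := by exact_mod_cast hn
  have h1 : Real.log (1 + (n : ℝ) ^ 2) ≤ 3 * Real.log n := by
    rw [← Real.log_rpow (by positivity)]
    apply Real.log_le_log (by positivity)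
    have : (n : ℝ) ^ (3 : ℝ) = (n : ℝ) ^ 3 := by exact_mod_cast Real.rpow_natCast (n : ℝ) 3
    rw [this]
    nlinarith [mul_nonneg (sub_nonneg.2 hn2) (sq_nonneg (n : ℝ))]
  have h2 : Real.log 2 ≤ Real.log n := Real.log_le_log (by norm_num) hn2
  have := Real.log_two_gt_d9
  unfold logScale
  linarith

lemma tendsto_logScale_mul_rpow {η : ℝ} (hη : 0 < η) :
    Tendsto (fun n : ℕ => logScale n * (n : ℝ) ^ (-η)) atTop (𝓝 0) := by
  have h1 : Tendsto (fun n : ℕ => 5 * (Real.log n / (n : ℝ) ^ η)) atTop (𝓝 (5 * 0)) :=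
    ((isLittleO_log_rpow_atTop hη).tendsto_div_nhds_zero.comp
      tendsto_natCast_atTop_atTop).const_mul 5
  rw [mul_zero] at h1
  refine squeeze_zero' (Eventually.of_forall fun n => ?_) ?_ h1
  · have := one_le_logScale n
    positivity
  · filter_upwards [eventually_ge_atTop 2] with n hn
    rw [Real.rpow_neg (by positivity), ← div_eq_mul_inv, ← mul_div_assoc]
    gcongr
    exact logScale_le hn

lemma tendsto_natCast_rpow_neg {η : ℝ} (hη : 0 < η) :
    Tendsto (fun n : ℕ => (n : ℝ) ^ (-η)) atTop (𝓝 0) :=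
  (tendsto_rpow_neg_atTop hη).comp tendsto_natCast_atTop_atTop

/-- Markov's inequality for the fluctuation of the periodogram. -/
lemma IsMaternProcess.tendsto_measure_fluctuation {Ω : Type*} [MeasurableSpace Ω] {P : Measure Ω}
    [IsProbabilityMeasure P] {ξ : ℝ → Ω → ℝ} {θ : MaternParam} (hξ : IsMaternProcess ξ θ P)
    (hν : 0 < θ.nu) (hφ : 0 < θ.phi) (hα : 0 < θ.alpha) {σ S : ℝ} (hσ : 1 / 2 < σ) (hσS : σ ≤ S)
    (k : ℕ) {γ : ℝ} (hγ : γ < 1 / 2) :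
    Tendsto (fun n : ℕ => P {ω | (n : ℝ) ^ (-γ) ≤
      fluctuation σ S k n (periodogram θ n (gridData (fun x => ξ x ω) n))}) atTop (𝓝 0) := by
  obtain ⟨K, hK0, hK⟩ := exists_integral_fluctuation_le (P := P) hσ hσS
    (variance (fun x : ℝ => x ^ 2) (gaussianReal 0 1))
  have hlim : Tendsto (fun n : ℕ => ENNReal.ofReal (K * (logScale n * (n : ℝ) ^ (-(1 / 2 - γ)))))
      atTop (𝓝 0) := by
    have := ENNReal.tendsto_ofReal ((tendsto_logScale_mul_rpow (sub_pos.2 hγ)).const_mul K)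
    simpa using this
  refine tendsto_of_tendsto_of_tendsto_of_le_of_le' tendsto_const_nhds hlim
    (Eventually.of_forall fun n => zero_le) ?_
  filter_upwards [eventually_ge_atTop 1] with n hn
  have hn0 : (0 : ℝ) < n := by exact_mod_cast (by omega : 0 < n)
  obtain ⟨h1, h2, h3, h4⟩ := hξ.periodogram_moments hν hφ hα hn
  obtain ⟨hint, hle⟩ := hK k n hn _ h1 h2 h3 h4
  have hnonneg : ∀ ω, 0 ≤ fluctuation σ S k n (periodogram θ n (gridData (fun x => ξ x ω) n)) :=
    fun ω => (abs_nonneg _).trans (fluctuation_parts (periodogram_nonneg hν hφ hα hn _) hn le_rfl).1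
  have hmarkov := mul_meas_ge_le_integral_of_nonneg (Eventually.of_forall hnonneg) hint
    ((n : ℝ) ^ (-γ))
  rw [← ENNReal.ofReal_toReal (measure_ne_top P _)]
  apply ENNReal.ofReal_le_ofReal
  have hpow : 0 < (n : ℝ) ^ (-γ) := by positivity
  have h5 := hmarkov.trans hle
  rw [Measure.real, mul_comm, ← le_div_iff₀ hpow] at h5
  refine h5.trans_eq ?_
  rw [show -(1 / 2 - γ) = -(1 / 2) - (-γ) by ring, Real.rpow_sub hn0, Real.rpow_neg hn0.le (1 / 2),
    ← Real.sqrt_eq_rpow]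
  ring

lemma tendstoInMeasure_zero_of_bound {Ω : Type*} [MeasurableSpace Ω] {P : Measure Ω}
    {X : ℕ → Ω → ℝ} {E : ℕ → Set Ω} {ρ : ℕ → ℝ} (hE : Tendsto (fun n => P (E n)) atTop (𝓝 0))
    (hρ : Tendsto ρ atTop (𝓝 0)) (hX : ∀ᶠ n in atTop, ∀ ω ∉ E n, |X n ω| ≤ ρ n) :
    TendstoInMeasure P X atTop fun _ => 0 := by
  rw [tendstoInMeasure_iff_norm]
  intro ε hε
  refine tendsto_of_tendsto_of_tendsto_of_le_of_le' tendsto_const_nhds hE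
    (Eventually.of_forall fun n => zero_le) ?_
  filter_upwards [hX, hρ.eventually_lt_const hε] with n hn hρn
  refine measure_mono fun ω hω => ?_
  by_contra hcon
  have h1 := hn ω hcon
  have h2 : ε ≤ |X n ω| := by simpa using hω
  linarith


/-! ### Rates of convergence -/

/-- Deterministic form of the rates: outside the events on which the fluctuation exceeds `n ^ (-γ)`
or the estimate is not a minimiser, both errors are bounded by explicit null sequences. -/
lemma exists_rate_bounds {θ₀ : MaternParam} (hν₀ : 0 < θ₀.nu) (hφ₀ : 0 < θ₀.phi)
    (hα₀ : 0 < θ₀.alpha) {aν bν aα bα : ℝ} (haν : 0 < aν) (hν₀_mem : θ₀.nu ∈ Icc aν bν)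
    (haα : 0 < aα) (hα : aα ≤ bα) {β γ : ℝ} (hβ : 0 < β) (hγ : 2 * β < γ) (hγ1 : γ < 1) :
    ∃ k : ℕ, ∃ ρ ψ : ℕ → ℝ, Tendsto ρ atTop (𝓝 0) ∧ Tendsto ψ atTop (𝓝 0) ∧
      ∀ᶠ n : ℕ in atTop, ∀ (z : Fin n → ℝ) (θ : MaternParam),
        fluctuation (aν + 1 / 2) (bν + 1 / 2) k n (periodogram θ₀ n z) ≤ (n : ℝ) ^ (-γ) →
        IsMLE (paramSet (Icc aν bν) (Icc aα bα)) n z θ →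
        |(θ.nu - θ₀.nu) / (n : ℝ) ^ (-β)| ≤ ρ n ∧
        |(θ.phi - θ₀.phi) / (Real.log n * (n : ℝ) ^ (-β))| ≤ ψ n := by
  have hσ : (1 : ℝ) / 2 < aν + 1 / 2 := by linarith
  have hσS : aν + 1 / 2 ≤ bν + 1 / 2 := by linarith [hν₀_mem.1, hν₀_mem.2]
  -- A common compact range for `α`, `α₀` and the reference value `1`.
  obtain ⟨a, ha, ha1, haα₀, haaα⟩ : ∃ a : ℝ, 0 < a ∧ a ≤ 1 ∧ a ≤ θ₀.alpha ∧ a ≤ aα :=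
    ⟨min 1 (min θ₀.alpha aα), by positivity, min_le_left _ _,
      (min_le_right _ _).trans (min_le_left _ _), (min_le_right _ _).trans (min_le_right _ _)⟩
  obtain ⟨b, hb1, hbα₀, hbbα⟩ : ∃ b : ℝ, 1 ≤ b ∧ θ₀.alpha ≤ b ∧ bα ≤ b :=
    ⟨max 1 (max θ₀.alpha bα), le_max_left _ _, (le_max_left _ _).trans (le_max_right _ _),
      (le_max_right _ _).trans (le_max_right _ _)⟩
  obtain ⟨k, hk, C₁, hC₁, h₁⟩ := exists_sq_nu_sub_le hσ hσS ha ha1 hb1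
  obtain ⟨C₂, hC₂, h₂⟩ := exists_abs_avg_exp_logRatio_sub_one_le hσ hσS ha ha1 hb1
  have hρ : Tendsto (fun n : ℕ => √(2 * C₁ * (logScale n * (n : ℝ) ^ (-(γ - 2 * β))))) atTop
      (𝓝 0) := by
    have h := ((tendsto_logScale_mul_rpow (sub_pos.2 hγ)).const_mul (2 * C₁)).sqrt
    simpa using h
  refine ⟨k, fun n => √(2 * C₁ * (logScale n * (n : ℝ) ^ (-(γ - 2 * β)))),
    fun n => θ₀.phi * C₂ * (5 * √(2 * C₁ * (logScale n * (n : ℝ) ^ (-(γ - 2 * β)))) +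
      2 * (n : ℝ) ^ (-(γ - β))), hρ, ?_, ?_⟩
  · have h := ((hρ.const_mul 5).add ((tendsto_natCast_rpow_neg
      (by linarith : 0 < γ - β)).const_mul 2)).const_mul (θ₀.phi * C₂)
    simpa using h
  have hk0 : (0 : ℝ) < k := by exact_mod_cast (by omega : 0 < k)
  have hsmall : Tendsto (fun n : ℕ => C₂ * (logScale n * (n : ℝ) ^ (-β)) *
      √(2 * C₁ * (logScale n * (n : ℝ) ^ (-(γ - 2 * β))))) atTop (𝓝 0) := by
    have h := ((tendsto_logScale_mul_rpow hβ).const_mul C₂).mul hρ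
    simpa using h
  filter_upwards [eventually_ge_atTop (4 * k), hsmall.eventually_le_const one_pos,
    (tendsto_natCast_rpow_neg (by linarith : 0 < γ)).eventually_le_const
      (by positivity : (0 : ℝ) < 1 / (8 * k))] with n hn hsm hTk
  intro z θ hfl hmle
  have hn2 : 2 ≤ n := by omega
  have hn1 : 1 ≤ n := by omega
  have hn1' : (1 : ℝ) ≤ n := by exact_mod_cast hn1
  have hn0 : (0 : ℝ) < n := by linarith
  have hΛ := one_le_logScale n
  set U := periodogram θ₀ n z with hUdef
  set r := √(2 * C₁ * (logScale n * (n : ℝ) ^ (-(γ - 2 * β)))) with hr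
  have hU := periodogram_nonneg hν₀ hφ₀ hα₀ hn1 z
  have hT1 : (n : ℝ) ^ (-γ) ≤ 1 / 2 := by
    refine hTk.trans ?_
    have : (2 : ℝ) ≤ k := by exact_mod_cast hk
    rw [div_le_div_iff₀ (by positivity) (by norm_num)]
    linarith
  have hmean := (fluctuation_parts hU hn1 hfl).1
  have hpos : 0 < avg U := by linarith [(abs_le.1 hmean).1]
  obtain ⟨hphi, hprof⟩ := hmle.profile hν₀ hφ₀ hα₀ (fun ν hν => haν.trans_le hν.1)
    (fun α hα' => haα.trans_le hα'.1) hn1 hpos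
  obtain ⟨⟨hν, -, hα'⟩, -⟩ := hmle
  have hν₀' : θ₀.nu + 1 / 2 ∈ Icc (aν + 1 / 2) (bν + 1 / 2) :=
    ⟨by linarith [hν₀_mem.1], by linarith [hν₀_mem.2]⟩
  have hν' : θ.nu + 1 / 2 ∈ Icc (aν + 1 / 2) (bν + 1 / 2) :=
    ⟨by linarith [hν.1], by linarith [hν.2]⟩
  have hα₀' : θ₀.alpha ∈ Icc a b := ⟨haα₀, hbα₀⟩
  have hαθ : θ.alpha ∈ Icc a b := ⟨haaα.trans hα'.1, hα'.2.trans hbbα⟩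
  -- The competitor has the true regularity and an arbitrary admissible range.
  have hsq := h₁ n hn U hU _ hfl hTk θ₀ θ ⟨θ₀.nu, θ₀.phi, aα⟩ hν₀' hν' rfl hα₀' hαθ
    ⟨haaα, hα.trans hbbα⟩ (hprof _ ⟨hν₀_mem, hφ₀, le_rfl, hα⟩)
  have hninv : 1 / (n : ℝ) ≤ (n : ℝ) ^ (-γ) := by
    rw [one_div, ← Real.rpow_neg_one]
    exact Real.rpow_le_rpow_of_exponent_le hn1' (by linarith)
  have hpβ : 0 < (n : ℝ) ^ (-β) := by positivity
  have hδ : |θ.nu - θ₀.nu| ≤ r * (n : ℝ) ^ (-β) := by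
    have h3 : (θ.nu - θ₀.nu) ^ 2 ≤ (2 * C₁ * (logScale n * (n : ℝ) ^ (-(γ - 2 * β)))) *
        ((n : ℝ) ^ (-β)) ^ 2 := by
      have h4 : (n : ℝ) ^ (-(γ - 2 * β)) * ((n : ℝ) ^ (-β)) ^ 2 = (n : ℝ) ^ (-γ) := by
        rw [← Real.rpow_natCast, ← Real.rpow_mul hn0.le, ← Real.rpow_add hn0]
        congr 1; push_cast; ring
      calc (θ.nu - θ₀.nu) ^ 2 ≤ C₁ * logScale n * ((n : ℝ) ^ (-γ) + 1 / n) := hsq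
        _ ≤ C₁ * logScale n * ((n : ℝ) ^ (-γ) + (n : ℝ) ^ (-γ)) := by gcongr
        _ = 2 * C₁ * (logScale n * (n : ℝ) ^ (-γ)) := by ring
        _ = _ := by rw [← h4]; ring
    have h5 := Real.abs_le_sqrt h3
    rwa [Real.sqrt_mul (by positivity), Real.sqrt_sq hpβ.le] at h5
  have hr0 : 0 ≤ r := Real.sqrt_nonneg _
  refine ⟨by rw [abs_div, abs_of_pos hpβ, div_le_iff₀ hpβ]; exact hδ, ?_⟩
  have hδ1 : C₂ * logScale n * |θ.nu - θ₀.nu| ≤ 1 := by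
    refine le_trans ?_ hsm
    calc C₂ * logScale n * |θ.nu - θ₀.nu| ≤ C₂ * logScale n * (r * (n : ℝ) ^ (-β)) := by gcongr
      _ = _ := by ring
  have hamp := h₂ k n hn1 U hU _ hfl (by linarith) θ₀ θ hν₀' hν' hα₀' hαθ hδ1
  have hlog : 1 / 2 ≤ Real.log n := by
    have h3 : Real.log 2 ≤ Real.log n :=
      Real.log_le_log (by norm_num) (by exact_mod_cast hn2)
    linarith [Real.log_two_gt_d9]
  have hlogβ : 0 < Real.log n * (n : ℝ) ^ (-β) := by positivity
  rw [abs_div, abs_of_pos hlogβ, div_le_iff₀ hlogβ, hphi, show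
    ∀ x : ℝ, θ₀.phi * x - θ₀.phi = θ₀.phi * (x - 1) from fun x => by ring, abs_mul,
    abs_of_pos hφ₀]
  have h6 : logScale n * |θ.nu - θ₀.nu| ≤ 5 * r * (Real.log n * (n : ℝ) ^ (-β)) := by
    calc logScale n * |θ.nu - θ₀.nu| ≤ (5 * Real.log n) * (r * (n : ℝ) ^ (-β)) :=
          mul_le_mul (logScale_le hn2) hδ (abs_nonneg _) (by positivity)
      _ = _ := by ring
  have h7 : (n : ℝ) ^ (-γ) ≤ 2 * (n : ℝ) ^ (-(γ - β)) * (Real.log n * (n : ℝ) ^ (-β)) := by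
    have h8 : (n : ℝ) ^ (-γ) = (n : ℝ) ^ (-(γ - β)) * (n : ℝ) ^ (-β) := by
      rw [← Real.rpow_add hn0]; congr 1; ring
    have h9 : 0 < (n : ℝ) ^ (-(γ - β)) * (n : ℝ) ^ (-β) := by positivity
    rw [h8]
    nlinarith
  calc θ₀.phi * |avg (fun m => Real.exp (logRatio θ₀ θ n m) * U m) - 1| ≤
        θ₀.phi * (C₂ * (logScale n * |θ.nu - θ₀.nu| + (n : ℝ) ^ (-γ))) := by gcongr
    _ ≤ θ₀.phi * (C₂ * (5 * r * (Real.log n * (n : ℝ) ^ (-β)) +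
        2 * (n : ℝ) ^ (-(γ - β)) * (Real.log n * (n : ℝ) ^ (-β)))) := by gcongr
    _ = _ := by ring

theorem mainTheorem2
    {Ω : Type*} [MeasurableSpace Ω] (P : Measure Ω) [IsProbabilityMeasure P]
    (θ₀ : MaternParam) (hν₀ : 0 < θ₀.nu) (hφ₀ : 0 < θ₀.phi) (hα₀ : 0 < θ₀.alpha)
    (ξ : ℝ → Ω → ℝ) (hξ : IsMaternProcess ξ θ₀ P)
    (aν bν aα bα : ℝ) (haν : 0 < aν) (hν₀_mem : θ₀.nu ∈ Icc aν bν)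
    (haα : 0 < aα) (hα : aα ≤ bα)
    (θhat : ℕ → Ω → MaternParam)
    (hθhat : ∀ n : ℕ, 1 ≤ n → ∀ᵐ ω ∂P,
      IsMLE (paramSet (Icc aν bν) (Icc aα bα)) n (gridData (fun x => ξ x ω) n) (θhat n ω))
    (β : ℝ) (hβ : 0 < β) (hβ' : β < 1 / 4) :
    IsLittleOInProbability P (fun n ω => (θhat n ω).nu - θ₀.nu)
        (fun n => (n : ℝ) ^ (-β)) ∧
      IsLittleOInProbability P (fun n ω => (θhat n ω).phi - θ₀.phi)
        (fun n => Real.log n * (n : ℝ) ^ (-β)) := by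
  obtain ⟨k, ρ, ψ, hρ, hψ, hbound⟩ := exists_rate_bounds hν₀ hφ₀ hα₀ haν hν₀_mem haα hα hβ
    (γ := β + 1 / 4) (by linarith) (by linarith)
  -- The exceptional events: large fluctuations, or an estimate that is not a minimiser.
  set E : ℕ → Set Ω := fun n => {ω | (n : ℝ) ^ (-(β + 1 / 4)) ≤
      fluctuation (aν + 1 / 2) (bν + 1 / 2) k n
        (periodogram θ₀ n (gridData (fun x => ξ x ω) n))} ∪
    {ω | ¬ IsMLE (paramSet (Icc aν bν) (Icc aα bα)) n (gridData (fun x => ξ x ω) n) (θhat n ω)}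
    with hE
  have hPE : Tendsto (fun n => P (E n)) atTop (𝓝 0) := by
    have hfl := hξ.tendsto_measure_fluctuation hν₀ hφ₀ hα₀ (σ := aν + 1 / 2) (S := bν + 1 / 2)
      (by linarith) (by linarith [hν₀_mem.1, hν₀_mem.2]) k (γ := β + 1 / 4) (by linarith)
    refine tendsto_of_tendsto_of_tendsto_of_le_of_le' tendsto_const_nhds hfl
      (Eventually.of_forall fun n => zero_le) ?_
    filter_upwards [eventually_ge_atTop 1] with n hn
    refine (measure_union_le _ _).trans_eq ?_
    rw [ae_iff.1 (hθhat n hn), add_zero]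
  have hgood : ∀ᶠ n in atTop, ∀ ω ∉ E n,
      |((θhat n ω).nu - θ₀.nu) / (n : ℝ) ^ (-β)| ≤ ρ n ∧
      |((θhat n ω).phi - θ₀.phi) / (Real.log n * (n : ℝ) ^ (-β))| ≤ ψ n := by
    filter_upwards [hbound] with n hn ω hω
    simp only [hE, mem_union, not_or] at hω
    exact hn _ _ (not_le.1 hω.1).le (not_not.1 hω.2)
  exact ⟨tendstoInMeasure_zero_of_bound hPE hρ (hgood.mono fun n hn ω hω => (hn ω hω).1),
    tendstoInMeasure_zero_of_bound hPE hψ (hgood.mono fun n hn ω hω => (hn ω hω).2)⟩
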